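/- Let $K$ be a field (for instance $\mathbf C$), $I$ a finite index set, and $R=(R^{ij}_{kl})_{i,j,k,l\in I}$ an invertible matrix over $K$ satisfying the Yang–Baxter equation $R_{12}R_{13}R_{23}=R_{23}R_{13}R_{12}$. Let $Y_-$ be the $K$-bialgebra with generators $t^i_j,E_i$ ($i,j\in I$) and $Y_+$ the $K$-bialgebra with generators $u^i_j,F^i$, with relations (in matrix notation $T=(t^i_j)$, $U=(u^i_j)$, $E$ a row, $F$ a column) $$R_{12}T_1T_2=T_2T_1R_{12},\quad E_1T_2=T_2E_1R_{12},\qquad R_{12}U_1U_2=U_2U_1R_{12},\quad F_2U_1=R_{12}U_1F_2,$$ that is, $\sum_{a,b} R^{ij}_{ab}t^a_kt^b_l=\sum_{a,b} t^j_bt^i_aR^{ab}_{kl}$ (and likewise for $u$), $E_kt^j_l=\sum_{a,b} t^j_bE_aR^{ab}_{kl}$, $F^ju^i_k=\sum_{a,b} R^{ij}_{ab}u^a_kF^b$; comultiplication $\Delta t^i_j=\sum_p t^i_p\otimes t^p_j$, $\Delta E_i=\sum_pE_p\otimes t^p_i+1\otimes E_i$, $\Delta u^i_j=\sum_p u^i_p\otimes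 u^p_j$, $\Delta F^i=F^i\otimes 1+\sum_pu^i_p\otimes F^p$; and counit $\varepsilon(t^i_j)=\varepsilon(u^i_j)=\delta^i_j$, $\varepsilon(E_i)=\varepsilon(F^i)=0$. There is exactly one bilinear pairing $\langle\,,\rangle:Y_+\times Y_-\to K$ with $\langle u^i_j,t^k_l\rangle=R^{ik}_{jl}$, $\langle F^i,E_j\rangle=\delta^i_j$, $\langle u^i_j,E_k\rangle=\langle F^i,t^k_l\rangle=0$ which is a skew pairing of bialgebras: $$\langle xy,a\rangle=\langle x\otimes y,\Delta(a)\rangle,\quad \langle x,ba\rangle=\langle\Delta(x),a\otimes b\rangle,\quad \langle 1,a\rangle=\varepsilon(a),\quad\langle x,1\rangle=\varepsilon(x).$$ Let $B^{ij}_{mn}=R^{ji}_{mn}$ be the braid matrix, let $B_m$ be $B$ acting in the tensor factors $m,m+1$ of $(K^I)^{\otimes N}$, and define the braided factorials by $[0!]_B=1$ and $$[N!]_B=\bigl(1\otimes[(N-1)!]_B\bigr)\bigl(1+B_1+B_1B_2+\dots+B_1B_2\cdots B_{N-1}\bigr).$$ Then for every $N\ge 0$: 1. $\langle F^{q_1}\cdots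 F^{q_N},E_{a_1}\cdots E_{a_N}\rangle=([N!]_B)^{q_1\dots q_N}_{a_1\dots a_N}$ for all indices (upper indices label rows, lower indices columns); 2. for coefficients $\omega=(\omega^{a_1\dots a_N})$ in $K$, the element $\sum_a E_{a_1}\cdots E_{a_N}\,\omega^{a_1\dots a_N}$ lies in the null ideal $\{y\in Y_-:\langle x,y\rangle=0\ \forall x\in Y_+\}$ if and only if $[N!]_B\,\omega=0$; 3. for coefficients $\eta=(\eta_{a_1\dots a_N})$ in $K$, the element $\sum_a\eta_{a_1\dots a_N}F^{a_1}\cdots F^{a_N}$ lies in the null ideal $\{x\in Y_+:\langle x,y\rangle=0\ \forall y\in Y_-\}$ if and only if $\eta\,[N!]_B=0$. Moreover, let $Y_-(T)\subset Y_-$ and $Y_+(U)\subset Y_+$ be the subalgebras generated by the $t^i_j$ and by the $u^i_j$, and let $J_-$ (resp. $J_+$) be the two-sided ideal of $Y_-$ (resp. $Y_+$) generated by the elements of $Y_-(T)$ (resp. $Y_+(U)$) that pair to zero with all of $Y_+(U)$ (resp. $Y_-(T)$). The pairing descends to a bilinear pairing of $Y_+/J_+$ with $Y_- /J_-$, and 2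 and 3 hold for the images of these elements and the induced pairing. -/

import Mathlib

open scoped TensorProduct

namespace YangBaxter

/-! Conventions. A numerical matrix `R = (R^{ij}_{kl})` is a matrix with rows `(i, j)` and columns
`(k, l)`: `R (i, j) (k, l) = R^{ij}_{kl}`. -/

section Matrices

variable {K ι : Type*} [Field K] [Fintype ι] [DecidableEq ι]

/-- `R` acting in the first and second factors of a threefold tensor product. -/
def leg12 (R : Matrix (ι × ι) (ι × ι) K) : Matrix (ι × ι × ι) (ι × ι × ι) K :=
  Matrix.of fun x y => if x.2.2 = y.2.2 then R (x.1, x.2.1) (y.1, y.2.1) else 0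

/-- `R` acting in the first and third factors of a threefold tensor product. -/
def leg13 (R : Matrix (ι × ι) (ι × ι) K) : Matrix (ι × ι × ι) (ι × ι × ι) K :=
  Matrix.of fun x y => if x.2.1 = y.2.1 then R (x.1, x.2.2) (y.1, y.2.2) else 0

/-- `R` acting in the second and third factors of a threefold tensor product. -/
def leg23 (R : Matrix (ι × ι) (ι × ι) K) : Matrix (ι × ι × ι) (ι × ι × ι) K :=
  Matrix.of fun x y => if x.1 = y.1 then R (x.2.1, x.2.2) (y.2.1, y.2.2) else 0

/-- The Yang-Baxter equation `R₁₂ R₁₃ R₂₃ = R₂₃ R₁₃ R₁₂`. -/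
def YangBaxterEq (R : Matrix (ι × ι) (ι × ι) K) : Prop :=
  leg12 R * leg13 R * leg23 R = leg23 R * leg13 R * leg12 R

/-- The braid matrix `B^{ij}_{mn} = R^{ji}_{mn}`. -/
def braidMatrix (R : Matrix (ι × ι) (ι × ι) K) : Matrix (ι × ι) (ι × ι) K :=
  Matrix.of fun x y => R (x.2, x.1) y

/-- The braid matrix acting in the adjacent tensor factors `m` and `m + 1` (counted from `0`) of
the `(N + 1)`-fold tensor power, and as the identity in all the others. -/
def braidAt (R : Matrix (ι × ι) (ι × ι) K) {N : ℕ} (m : Fin N) :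
    Matrix (Fin (N + 1) → ι) (Fin (N + 1) → ι) K :=
  Matrix.of fun q a =>
    if ∀ i, i ≠ m.castSucc → i ≠ m.succ → q i = a i then
      braidMatrix R (q m.castSucc, q m.succ) (a m.castSucc, a m.succ)
    else 0

/-- The braided integer `1 + B₁ + B₁ B₂ + ⋯ + B₁ B₂ ⋯ B_N` on the `(N + 1)`-fold tensor power. -/
def braidedInt (R : Matrix (ι × ι) (ι × ι) K) (N : ℕ) :
    Matrix (Fin (N + 1) → ι) (Fin (N + 1) → ι) K :=
  ∑ k ∈ Finset.range (N + 1), (((List.finRange N).take k).map (braidAt R)).prod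

/-- `1 ⊗ M`: the matrix `M` acting in all tensor factors but the first. -/
def oneTensor {N : ℕ} (M : Matrix (Fin N → ι) (Fin N → ι) K) :
    Matrix (Fin (N + 1) → ι) (Fin (N + 1) → ι) K :=
  Matrix.of fun q a => if q 0 = a 0 then M (Fin.tail q) (Fin.tail a) else 0

/-- The braided factorial `[N!]_B = [2]_{N-1,N} [3]_{N-2,…,N} ⋯ [N]_{1,…,N}`, the ordered product
of the braided integers in the last `2, 3, …, N` tensor factors. -/
def braidedFactorial (R : Matrix (ι × ι) (ι × ι) K) :
    (N : ℕ) → Matrix (Fin N → ι) (Fin N → ι) K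
  | 0 => 1
  | N + 1 => oneTensor (braidedFactorial R N) * braidedInt R N

end Matrices

/-! ### Compatibility of the comultiplications with the relations -/

theorem sum4_comm {ι M : Type*} [Fintype ι] [AddCommMonoid M] (f : ι → ι → ι → ι → M) :
    ∑ a, ∑ b, ∑ c, ∑ d, f a b c d = ∑ c, ∑ d, ∑ a, ∑ b, f a b c d := by
  have h (g : ι × ι → ι × ι → M) : ∑ x, ∑ y, g x y = ∑ y, ∑ x, g x y := Finset.sum_comm
  simpa [Fintype.sum_prod_type] using h fun x y => f x.1 x.2 y.1 y.2

theorem sum4_comm' {ι M : Type*} [Fintype ι] [AddCommMonoid M] (f : ι → ι → ι → ι → M) :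
    ∑ a, ∑ b, ∑ c, ∑ d, f a b c d = ∑ c, ∑ d, ∑ b, ∑ a, f a b c d := by
  rw [sum4_comm]
  exact Finset.sum_congr rfl fun c _ => Finset.sum_congr rfl fun d _ => Finset.sum_comm

section Comul

variable {K ι A : Type*} [Field K] [Fintype ι] [Ring A] [Algebra K A]

theorem comul_RTT {R : Matrix (ι × ι) (ι × ι) K} {t : ι → ι → A}
    (h : ∀ i j k l, ∑ a, ∑ b, R (i, j) (a, b) • (t a k * t b l) =
      ∑ a, ∑ b, R (a, b) (k, l) • (t j b * t i a)) (i j k l : ι) :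
    ∑ a, ∑ b, R (i, j) (a, b) • ((∑ p, t a p ⊗ₜ[K] t p k) * (∑ q, t b q ⊗ₜ[K] t q l)) =
      ∑ a, ∑ b, R (a, b) (k, l) • ((∑ q, t j q ⊗ₜ[K] t q b) * (∑ p, t i p ⊗ₜ[K] t p a)) := by
  calc _ = ∑ p, ∑ q, (∑ a, ∑ b, R (i, j) (a, b) • (t a p * t b q)) ⊗ₜ[K] (t p k * t q l) := by
        simp only [Finset.sum_mul_sum, Algebra.TensorProduct.tmul_mul_tmul, Finset.smul_sum,
          TensorProduct.sum_tmul, TensorProduct.smul_tmul']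
        rw [sum4_comm]
    _ = ∑ a, ∑ b, (t j b * t i a) ⊗ₜ[K] (∑ p, ∑ q, R (a, b) (p, q) • (t p k * t q l)) := by
        simp only [h i j, TensorProduct.sum_tmul]
        simp only [TensorProduct.tmul_sum, TensorProduct.tmul_smul, TensorProduct.smul_tmul']
        rw [sum4_comm]
    _ = _ := by
        simp only [h _ _ _ _, Finset.sum_mul_sum, Algebra.TensorProduct.tmul_mul_tmul,
          Finset.smul_sum, TensorProduct.tmul_sum, TensorProduct.tmul_smul]
        rw [sum4_comm']

theorem comul_ET {R : Matrix (ι × ι) (ι × ι) K} {t : ι → ι → A} {E : ι → A}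
    (h : ∀ i j k l, ∑ a, ∑ b, R (i, j) (a, b) • (t a k * t b l) =
      ∑ a, ∑ b, R (a, b) (k, l) • (t j b * t i a))
    (hE : ∀ j k l, E k * t j l = ∑ a, ∑ b, R (a, b) (k, l) • (t j b * E a)) (j k l : ι) :
    (∑ p, E p ⊗ₜ[K] t p k + 1 ⊗ₜ[K] E k) * (∑ q, t j q ⊗ₜ[K] t q l) =
      ∑ a, ∑ b, R (a, b) (k, l) •
        ((∑ q, t j q ⊗ₜ[K] t q b) * (∑ p, E p ⊗ₜ[K] t p a + 1 ⊗ₜ[K] E a)) := by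
  have h₁ : (∑ p, E p ⊗ₜ[K] t p k) * (∑ q, t j q ⊗ₜ[K] t q l) =
      ∑ a, ∑ b, R (a, b) (k, l) • ((∑ q, t j q ⊗ₜ[K] t q b) * (∑ p, E p ⊗ₜ[K] t p a)) := by
    calc _ = ∑ a, ∑ b, (t j b * E a) ⊗ₜ[K] (∑ p, ∑ q, R (a, b) (p, q) • (t p k * t q l)) := by
          simp only [Finset.sum_mul_sum, Algebra.TensorProduct.tmul_mul_tmul, hE,
            TensorProduct.sum_tmul, TensorProduct.tmul_sum, TensorProduct.tmul_smul,
            TensorProduct.smul_tmul']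
          rw [sum4_comm]
      _ = _ := by
          simp only [h _ _ _ _, Finset.sum_mul_sum, Algebra.TensorProduct.tmul_mul_tmul,
            Finset.smul_sum, TensorProduct.tmul_sum, TensorProduct.tmul_smul]
          rw [sum4_comm']
  have h₂ : (1 ⊗ₜ[K] E k) * (∑ q, t j q ⊗ₜ[K] t q l) =
      ∑ a, ∑ b, R (a, b) (k, l) • ((∑ q, t j q ⊗ₜ[K] t q b) * (1 ⊗ₜ[K] E a)) := by
    simp only [Finset.mul_sum, Finset.sum_mul, Algebra.TensorProduct.tmul_mul_tmul, one_mul,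
      mul_one, hE, Finset.smul_sum, TensorProduct.tmul_sum, TensorProduct.tmul_smul]
    rw [Finset.sum_comm]
    exact Finset.sum_congr rfl fun a _ => by rw [Finset.sum_comm]
  simp only [add_mul, mul_add, smul_add, Finset.sum_add_distrib, h₁, h₂]

theorem comul_FU {R : Matrix (ι × ι) (ι × ι) K} {u : ι → ι → A} {F : ι → A}
    (h : ∀ i j k l, ∑ a, ∑ b, R (i, j) (a, b) • (u a k * u b l) =
      ∑ a, ∑ b, R (a, b) (k, l) • (u j b * u i a))
    (hF : ∀ i j k, F j * u i k = ∑ a, ∑ b, R (i, j) (a, b) • (u a k * F b)) (i j k : ι) :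
    (F j ⊗ₜ[K] 1 + ∑ q, u j q ⊗ₜ[K] F q) * (∑ p, u i p ⊗ₜ[K] u p k) =
      ∑ a, ∑ b, R (i, j) (a, b) •
        ((∑ p, u a p ⊗ₜ[K] u p k) * (F b ⊗ₜ[K] 1 + ∑ q, u b q ⊗ₜ[K] F q)) := by
  have h₁ : (∑ q, u j q ⊗ₜ[K] F q) * (∑ p, u i p ⊗ₜ[K] u p k) =
      ∑ a, ∑ b, R (i, j) (a, b) • ((∑ p, u a p ⊗ₜ[K] u p k) * (∑ q, u b q ⊗ₜ[K] F q)) := by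
    calc _ = ∑ a, ∑ b, (∑ p, ∑ q, R (p, q) (a, b) • (u j q * u i p)) ⊗ₜ[K] (u a k * F b) := by
          simp only [Finset.sum_mul_sum, Algebra.TensorProduct.tmul_mul_tmul, hF,
            TensorProduct.sum_tmul, TensorProduct.tmul_sum, TensorProduct.tmul_smul,
            TensorProduct.smul_tmul']
          rw [sum4_comm']
      _ = _ := by
          simp only [← h _ _ _ _, Finset.sum_mul_sum, Algebra.TensorProduct.tmul_mul_tmul,
            Finset.smul_sum, TensorProduct.sum_tmul, TensorProduct.smul_tmul']
          rw [sum4_comm]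
  have h₂ : (F j ⊗ₜ[K] 1) * (∑ p, u i p ⊗ₜ[K] u p k) =
      ∑ a, ∑ b, R (i, j) (a, b) • ((∑ p, u a p ⊗ₜ[K] u p k) * (F b ⊗ₜ[K] 1)) := by
    simp only [Finset.mul_sum, Finset.sum_mul, Algebra.TensorProduct.tmul_mul_tmul, one_mul,
      mul_one, hF, Finset.smul_sum, TensorProduct.sum_tmul, TensorProduct.smul_tmul']
    rw [Finset.sum_comm]
    exact Finset.sum_congr rfl fun a _ => by rw [Finset.sum_comm]
  simp only [add_mul, mul_add, smul_add, Finset.sum_add_distrib, h₁, h₂]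

end Comul

/-! ### The bialgebras `Y₋`, with generators `t^i_j`, `E_i`, and `Y₊`, with generators `u^i_j`,
`F^i` -/

/-- Generators of `Y₋`: `t i j` stands for `t^i_j` and `E i` for `E_i`. -/
inductive MinusGen (ι : Type*) where
  | t : ι → ι → MinusGen ι
  | E : ι → MinusGen ι

/-- Generators of `Y₊`: `u i j` stands for `u^i_j` and `F i` for `F^i`. -/
inductive PlusGen (ι : Type*) where
  | u : ι → ι → PlusGen ι
  | F : ι → PlusGen ι

section Minus

variable {K ι : Type*} [Field K] [Fintype ι]

/-- The relations `R₁₂ T₁ T₂ = T₂ T₁ R₁₂` and `E₁ T₂ = T₂ E₁ R₁₂`, entry by entry. -/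
inductive MinusRel (R : Matrix (ι × ι) (ι × ι) K) :
    FreeAlgebra K (MinusGen ι) → FreeAlgebra K (MinusGen ι) → Prop
  | RTT (i j k l : ι) : MinusRel R
      (∑ a, ∑ b, R (i, j) (a, b) •
        (FreeAlgebra.ι K (MinusGen.t a k) * FreeAlgebra.ι K (MinusGen.t b l)))
      (∑ a, ∑ b, R (a, b) (k, l) •
        (FreeAlgebra.ι K (MinusGen.t j b) * FreeAlgebra.ι K (MinusGen.t i a)))
  | ET (j k l : ι) : MinusRel R
      (FreeAlgebra.ι K (MinusGen.E k) * FreeAlgebra.ι K (MinusGen.t j l))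
      (∑ a, ∑ b, R (a, b) (k, l) •
        (FreeAlgebra.ι K (MinusGen.t j b) * FreeAlgebra.ι K (MinusGen.E a)))

/-- The algebra `Y₋` generated by the entries of `T` and `E` subject to `MinusRel`. -/
def YMinus (R : Matrix (ι × ι) (ι × ι) K) : Type _ := RingQuot (MinusRel R)

variable (R : Matrix (ι × ι) (ι × ι) K)

noncomputable instance : Ring (YMinus R) := inferInstanceAs (Ring (RingQuot (MinusRel R)))

noncomputable instance : Algebra K (YMinus R) :=
  inferInstanceAs (Algebra K (RingQuot (MinusRel R)))

/-- The canonical projection from the free algebra onto `Y₋`. -/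
noncomputable def minusMk : FreeAlgebra K (MinusGen ι) →ₐ[K] YMinus R :=
  RingQuot.mkAlgHom K (MinusRel R)

/-- The generator `t^i_j` of `Y₋`. -/
noncomputable def t (i j : ι) : YMinus R := minusMk R (FreeAlgebra.ι K (MinusGen.t i j))

/-- The generator `E_i` of `Y₋`. -/
noncomputable def E (i : ι) : YMinus R := minusMk R (FreeAlgebra.ι K (MinusGen.E i))

theorem RTT (i j k l : ι) :
    ∑ a, ∑ b, R (i, j) (a, b) • (t R a k * t R b l) =
      ∑ a, ∑ b, R (a, b) (k, l) • (t R j b * t R i a) := by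
  have h : minusMk R _ = minusMk R _ := RingQuot.mkAlgHom_rel K (MinusRel.RTT (R := R) i j k l)
  simpa [t] using h

theorem ET (j k l : ι) :
    E R k * t R j l = ∑ a, ∑ b, R (a, b) (k, l) • (t R j b * E R a) := by
  have h : minusMk R _ = minusMk R _ := RingQuot.mkAlgHom_rel K (MinusRel.ET (R := R) j k l)
  simpa [t, E] using h

variable {R} in
/-- The universal property of `Y₋`. -/
noncomputable def minusLift {A : Type*} [Ring A] [Algebra K A] (f : MinusGen ι → A)
    (hRTT : ∀ i j k l, ∑ a, ∑ b, R (i, j) (a, b) • (f (.t a k) * f (.t b l)) =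
      ∑ a, ∑ b, R (a, b) (k, l) • (f (.t j b) * f (.t i a)))
    (hET : ∀ j k l, f (.E k) * f (.t j l) =
      ∑ a, ∑ b, R (a, b) (k, l) • (f (.t j b) * f (.E a))) : YMinus R →ₐ[K] A :=
  RingQuot.liftAlgHom K (s := MinusRel R) ⟨FreeAlgebra.lift K f, by
    rintro _ _ (⟨i, j, k, l⟩ | ⟨j, k, l⟩)
    · simpa using hRTT i j k l
    · simpa using hET j k l⟩

variable {R} in
theorem minusLift_mk {A : Type*} [Ring A] [Algebra K A] (f : MinusGen ι → A) (h₁) (h₂)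
    (x : MinusGen ι) :
    minusLift (R := R) f h₁ h₂ (minusMk R (FreeAlgebra.ι K x)) = f x := by
  refine (RingQuot.liftAlgHom_mkAlgHom_apply K _ _ _).trans ?_
  simp

variable {R} in
theorem minus_hom_ext {A : Type*} [Ring A] [Algebra K A] {f g : YMinus R →ₐ[K] A}
    (ht : ∀ i j, f (t R i j) = g (t R i j)) (hE : ∀ i, f (E R i) = g (E R i)) : f = g := by
  refine RingQuot.ringQuot_ext' K f g (FreeAlgebra.hom_ext (funext ?_))
  rintro (⟨i, j⟩ | i)
  · exact ht i j
  · exact hE i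

/-- The comultiplication on generators: `Δ(T) = T ⊗ T`, `Δ(E) = E ⊗ T + 1 ⊗ E`. -/
noncomputable def minusComulGen : MinusGen ι → YMinus R ⊗[K] YMinus R
  | .t i j => ∑ p, t R i p ⊗ₜ[K] t R p j
  | .E i => ∑ p, E R p ⊗ₜ[K] t R p i + 1 ⊗ₜ[K] E R i

/-- The counit on generators: `ε(T) = 1`, `ε(E) = 0`. -/
def minusCounitGen [DecidableEq ι] : MinusGen ι → K
  | .t i j => if i = j then 1 else 0
  | .E _ => 0

/-- The comultiplication of `Y₋`. -/
noncomputable def minusComul : YMinus R →ₐ[K] YMinus R ⊗[K] YMinus R :=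
  minusLift (minusComulGen R) (comul_RTT (RTT R)) (comul_ET (RTT R) (ET R))

/-- The counit of `Y₋`. -/
noncomputable def minusCounit [DecidableEq ι] : YMinus R →ₐ[K] K :=
  minusLift minusCounitGen
    (by intro i j k l; simp [minusCounitGen])
    (by intro j k l; simp [minusCounitGen])

theorem minusComul_t (i j : ι) :
    minusComul R (t R i j) = ∑ p, t R i p ⊗ₜ[K] t R p j := minusLift_mk _ _ _ _

theorem minusComul_E (i : ι) :
    minusComul R (E R i) = ∑ p, E R p ⊗ₜ[K] t R p i + 1 ⊗ₜ[K] E R i := minusLift_mk _ _ _ _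

theorem minusCounit_t [DecidableEq ι] (i j : ι) :
    minusCounit R (t R i j) = if i = j then 1 else 0 := minusLift_mk _ _ _ _

theorem minusCounit_E [DecidableEq ι] (i : ι) : minusCounit R (E R i) = 0 := minusLift_mk _ _ _ _

noncomputable instance [DecidableEq ι] : Bialgebra K (YMinus R) :=
  Bialgebra.ofAlgHom (minusComul R) (minusCounit R)
    (minus_hom_ext
      (by
        intro i j
        simp [minusComul_t, TensorProduct.sum_tmul, TensorProduct.tmul_sum]
        rw [Finset.sum_comm])
      (by
        intro i
        simp [Algebra.TensorProduct.one_def, minusComul_t, minusComul_E, TensorProduct.sum_tmul,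
          TensorProduct.tmul_sum, TensorProduct.add_tmul, TensorProduct.tmul_add, Finset.sum_add_distrib, add_assoc]
        rw [Finset.sum_comm]))
    (minus_hom_ext
      (by
        intro i j
        simp [minusComul_t, minusCounit_t, TensorProduct.ite_tmul])
      (by
        intro i
        simp [minusComul_E, minusCounit_E]))
    (minus_hom_ext
      (by
        intro i j
        simp [minusComul_t, minusCounit_t, TensorProduct.tmul_ite])
      (by
        intro i
        simp [minusComul_E, minusCounit_E, minusCounit_t, TensorProduct.tmul_ite]))

end Minus

section Plus

variable {K ι : Type*} [Field K] [Fintype ι]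

/-- The relations `R₁₂ U₁ U₂ = U₂ U₁ R₁₂` and `F₂ U₁ = R₁₂ U₁ F₂`, entry by entry. -/
inductive PlusRel (R : Matrix (ι × ι) (ι × ι) K) :
    FreeAlgebra K (PlusGen ι) → FreeAlgebra K (PlusGen ι) → Prop
  | RUU (i j k l : ι) : PlusRel R
      (∑ a, ∑ b, R (i, j) (a, b) •
        (FreeAlgebra.ι K (PlusGen.u a k) * FreeAlgebra.ι K (PlusGen.u b l)))
      (∑ a, ∑ b, R (a, b) (k, l) •
        (FreeAlgebra.ι K (PlusGen.u j b) * FreeAlgebra.ι K (PlusGen.u i a)))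
  | FU (i j k : ι) : PlusRel R
      (FreeAlgebra.ι K (PlusGen.F j) * FreeAlgebra.ι K (PlusGen.u i k))
      (∑ a, ∑ b, R (i, j) (a, b) •
        (FreeAlgebra.ι K (PlusGen.u a k) * FreeAlgebra.ι K (PlusGen.F b)))

/-- The algebra `Y₊` generated by the entries of `U` and `F` subject to `PlusRel`. -/
def YPlus (R : Matrix (ι × ι) (ι × ι) K) : Type _ := RingQuot (PlusRel R)

variable (R : Matrix (ι × ι) (ι × ι) K)

noncomputable instance : Ring (YPlus R) := inferInstanceAs (Ring (RingQuot (PlusRel R)))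

noncomputable instance : Algebra K (YPlus R) :=
  inferInstanceAs (Algebra K (RingQuot (PlusRel R)))

/-- The canonical projection from the free algebra onto `Y₊`. -/
noncomputable def plusMk : FreeAlgebra K (PlusGen ι) →ₐ[K] YPlus R :=
  RingQuot.mkAlgHom K (PlusRel R)

/-- The generator `u^i_j` of `Y₊`. -/
noncomputable def u (i j : ι) : YPlus R := plusMk R (FreeAlgebra.ι K (PlusGen.u i j))

/-- The generator `F^i` of `Y₊`. -/
noncomputable def F (i : ι) : YPlus R := plusMk R (FreeAlgebra.ι K (PlusGen.F i))

theorem RUU (i j k l : ι) :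
    ∑ a, ∑ b, R (i, j) (a, b) • (u R a k * u R b l) =
      ∑ a, ∑ b, R (a, b) (k, l) • (u R j b * u R i a) := by
  have h : plusMk R _ = plusMk R _ := RingQuot.mkAlgHom_rel K (PlusRel.RUU (R := R) i j k l)
  simpa [u] using h

theorem FU (i j k : ι) :
    F R j * u R i k = ∑ a, ∑ b, R (i, j) (a, b) • (u R a k * F R b) := by
  have h : plusMk R _ = plusMk R _ := RingQuot.mkAlgHom_rel K (PlusRel.FU (R := R) i j k)
  simpa [u, F] using h

variable {R} in
/-- The universal property of `Y₊`. -/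
noncomputable def plusLift {A : Type*} [Ring A] [Algebra K A] (f : PlusGen ι → A)
    (hRUU : ∀ i j k l, ∑ a, ∑ b, R (i, j) (a, b) • (f (.u a k) * f (.u b l)) =
      ∑ a, ∑ b, R (a, b) (k, l) • (f (.u j b) * f (.u i a)))
    (hFU : ∀ i j k, f (.F j) * f (.u i k) =
      ∑ a, ∑ b, R (i, j) (a, b) • (f (.u a k) * f (.F b))) : YPlus R →ₐ[K] A :=
  RingQuot.liftAlgHom K (s := PlusRel R) ⟨FreeAlgebra.lift K f, by
    rintro _ _ (⟨i, j, k, l⟩ | ⟨i, j, k⟩)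
    · simpa using hRUU i j k l
    · simpa using hFU i j k⟩

variable {R} in
theorem plusLift_mk {A : Type*} [Ring A] [Algebra K A] (f : PlusGen ι → A) (h₁) (h₂)
    (x : PlusGen ι) :
    plusLift (R := R) f h₁ h₂ (plusMk R (FreeAlgebra.ι K x)) = f x := by
  refine (RingQuot.liftAlgHom_mkAlgHom_apply K _ _ _).trans ?_
  simp

variable {R} in
theorem plus_hom_ext {A : Type*} [Ring A] [Algebra K A] {f g : YPlus R →ₐ[K] A}
    (hu : ∀ i j, f (u R i j) = g (u R i j)) (hF : ∀ i, f (F R i) = g (F R i)) : f = g := by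
  refine RingQuot.ringQuot_ext' K f g (FreeAlgebra.hom_ext (funext ?_))
  rintro (⟨i, j⟩ | i)
  · exact hu i j
  · exact hF i

/-- The comultiplication on generators: `Δ(U) = U ⊗ U`, `Δ(F) = F ⊗ 1 + U ⊗ F`. -/
noncomputable def plusComulGen : PlusGen ι → YPlus R ⊗[K] YPlus R
  | .u i j => ∑ p, u R i p ⊗ₜ[K] u R p j
  | .F i => F R i ⊗ₜ[K] 1 + ∑ p, u R i p ⊗ₜ[K] F R p

/-- The counit on generators: `ε(U) = 1`, `ε(F) = 0`. -/
def plusCounitGen [DecidableEq ι] : PlusGen ι → K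
  | .u i j => if i = j then 1 else 0
  | .F _ => 0

/-- The comultiplication of `Y₊`. -/
noncomputable def plusComul : YPlus R →ₐ[K] YPlus R ⊗[K] YPlus R :=
  plusLift (plusComulGen R) (comul_RTT (RUU R)) (comul_FU (RUU R) (FU R))

/-- The counit of `Y₊`. -/
noncomputable def plusCounit [DecidableEq ι] : YPlus R →ₐ[K] K :=
  plusLift plusCounitGen
    (by intro i j k l; simp [plusCounitGen])
    (by intro i j k; simp [plusCounitGen])

theorem plusComul_u (i j : ι) :
    plusComul R (u R i j) = ∑ p, u R i p ⊗ₜ[K] u R p j := plusLift_mk _ _ _ _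

theorem plusComul_F (i : ι) :
    plusComul R (F R i) = F R i ⊗ₜ[K] 1 + ∑ p, u R i p ⊗ₜ[K] F R p := plusLift_mk _ _ _ _

theorem plusCounit_u [DecidableEq ι] (i j : ι) :
    plusCounit R (u R i j) = if i = j then 1 else 0 := plusLift_mk _ _ _ _

theorem plusCounit_F [DecidableEq ι] (i : ι) : plusCounit R (F R i) = 0 := plusLift_mk _ _ _ _

noncomputable instance [DecidableEq ι] : Bialgebra K (YPlus R) :=
  Bialgebra.ofAlgHom (plusComul R) (plusCounit R)
    (plus_hom_ext
      (by
        intro i j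
        simp [plusComul_u, TensorProduct.sum_tmul, TensorProduct.tmul_sum]
        rw [Finset.sum_comm])
      (by
        intro i
        simp [Algebra.TensorProduct.one_def, plusComul_u, plusComul_F, TensorProduct.sum_tmul,
          TensorProduct.tmul_sum, TensorProduct.add_tmul, TensorProduct.tmul_add, Finset.sum_add_distrib, add_assoc]
        rw [Finset.sum_comm]))
    (plus_hom_ext
      (by
        intro i j
        simp [plusComul_u, plusCounit_u, TensorProduct.ite_tmul])
      (by
        intro i
        simp [plusComul_F, plusCounit_F, plusCounit_u, TensorProduct.ite_tmul]))
    (plus_hom_ext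
      (by
        intro i j
        simp [plusComul_u, plusCounit_u, TensorProduct.tmul_ite])
      (by
        intro i
        simp [plusComul_F, plusCounit_F]))

end Plus

/-! ### The pairing -/

section Pairing

variable {K ι : Type*} [Field K] [Fintype ι] [DecidableEq ι]

/-- `P x a = ⟨x, a⟩` is a skew pairing of the bialgebras `Y₊` and `Y₋` with `⟨U, T⟩ = R`,
`⟨F, E⟩ = 1`, and zero for the pairs `(U, E)` and `(F, T)`. The values `⟨1, T⟩ = ⟨U, 1⟩ = 1`,
`⟨1, E⟩ = ⟨F, 1⟩ = 0` are the cases of `one_left` and `one_right` at the generators. -/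
structure IsSkewPairing (R : Matrix (ι × ι) (ι × ι) K)
    (P : YPlus R →ₗ[K] YMinus R →ₗ[K] K) : Prop where
  /-- `⟨x y, a⟩ = ⟨x ⊗ y, Δ(a)⟩` -/
  mul_left (x y : YPlus R) (a : YMinus R) : P (x * y) a =
    LinearMap.mul' K K (TensorProduct.map (P x) (P y) (Coalgebra.comul a))
  /-- `⟨x, b a⟩ = ⟨Δ(x), a ⊗ b⟩` -/
  mul_right (x : YPlus R) (a b : YMinus R) : P x (b * a) =
    LinearMap.mul' K K (TensorProduct.map (P.flip a) (P.flip b) (Coalgebra.comul x))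
  one_left (a : YMinus R) : P 1 a = Coalgebra.counit (R := K) a
  one_right (x : YPlus R) : P x 1 = Coalgebra.counit (R := K) x
  u_t (i j k l : ι) : P (u R i j) (t R k l) = R (i, k) (j, l)
  F_E (i j : ι) : P (F R i) (E R j) = if i = j then 1 else 0
  u_E (i j k : ι) : P (u R i j) (E R k) = 0
  F_t (i k l : ι) : P (F R i) (t R k l) = 0

end Pairing

section Words

variable {K ι : Type*} [Field K] [Fintype ι]

/-- The monomial `E_{a_1} ⋯ E_{a_N}`. -/
noncomputable def wordE (R : Matrix (ι × ι) (ι × ι) K) {N : ℕ} (a : Fin N → ι) : YMinus R :=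
  (List.ofFn fun i => E R (a i)).prod

/-- The monomial `F^{q_1} ⋯ F^{q_N}`. -/
noncomputable def wordF (R : Matrix (ι × ι) (ι × ι) K) {N : ℕ} (q : Fin N → ι) : YPlus R :=
  (List.ofFn fun i => F R (q i)).prod

/-- The subalgebra of `Y₋` generated by the entries of `T`. -/
noncomputable def algT (R : Matrix (ι × ι) (ι × ι) K) : Subalgebra K (YMinus R) :=
  Algebra.adjoin K {a | ∃ i j, a = t R i j}

/-- The subalgebra of `Y₊` generated by the entries of `U`. -/
noncomputable def algU (R : Matrix (ι × ι) (ι × ι) K) : Subalgebra K (YPlus R) :=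
  Algebra.adjoin K {x | ∃ i j, x = u R i j}

variable {R : Matrix (ι × ι) (ι × ι) K}

/-- The ideal of `Y₋` generated by the pure-`T` null ideal, that is, by the elements of the
`T`-subalgebra which pair to zero with the whole `U`-subalgebra. -/
noncomputable def pureNullMinus (P : YPlus R →ₗ[K] YMinus R →ₗ[K] K) :
    TwoSidedIdeal (YMinus R) :=
  TwoSidedIdeal.span {a | a ∈ algT R ∧ ∀ x ∈ algU R, P x a = 0}

/-- The ideal of `Y₊` generated by the pure-`U` null ideal, that is, by the elements of the
`U`-subalgebra which pair to zero with the whole `T`-subalgebra. -/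
noncomputable def pureNullPlus (P : YPlus R →ₗ[K] YMinus R →ₗ[K] K) :
    TwoSidedIdeal (YPlus R) :=
  TwoSidedIdeal.span {x | x ∈ algU R ∧ ∀ a ∈ algT R, P x a = 0}

end Words

end YangBaxter

/-! A skew pairing is the same as a suitable algebra map from `YMinus R` to the opposite of the
convolution algebra of functionals on `YPlus R`. Compatibility with Δ on `Y₋` forces ⟨·, T⟩ to be
the coefficients of a matrix representation of `Y₊` (`pairT`), and ⟨·, E⟩ to be the corner of a
block triangular representation with diagonal blocks ε and `pairT` (`pairET`). The relations of `Y₋`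
then say that `extR R` intertwines the two tensor products of these representations
(`extR_mul_pairTET`). This need only be tested on generators of `Y₊`, where the essential case is
the Yang–Baxter equation. Uniqueness holds because the axioms propagate the values on generators to
all products.

For words, Δ(F) = F ⊗ 1 + U ⊗ F makes left multiplication by F^q a braided derivation
(`IsSkewPairing.F_mul_wordE`): F^q turns one letter E_a into t^q_a, which is carried to the front
past the earlier letters, each crossing costing one R. Summing over the letters gives the braided
integer. The t in front pairs with F-words through ε, so induction yields the braided factorial
(`IsSkewPairing.wordF_wordE`).

For the null elements, F U relations let `Y₊` be spanned by products X · (F-word) with X in `algU R`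
(`plus_mem_span`). Against E-words X contributes only ε(X), and words of different lengths pair to
zero, so nullity is decided by the matrix of the braided factorial. The argument for `Y₋` is the
mirror image. Finally, a factor ending in F pairs to zero with `algT R`, so pure null elements are
null for the whole pairing, which therefore descends. -/

namespace YangBaxter

/-! ### Induction on generators and the coalgebra structure there. -/

section Basics

variable {K ι : Type*} [Field K] [Fintype ι] {R : Matrix (ι × ι) (ι × ι) K}

theorem plus_induction {p : YPlus R → Prop} (scalar : ∀ r : K, p (algebraMap K _ r))
    (u : ∀ i j, p (u R i j)) (F : ∀ i, p (F R i)) (add : ∀ x y, p x → p y → p (x + y))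
    (mul : ∀ x y, p x → p y → p (x * y)) (x : YPlus R) : p x := by
  obtain ⟨x, rfl⟩ : ∃ y, plusMk R y = x := RingQuot.mkAlgHom_surjective K (PlusRel R) x
  induction x using FreeAlgebra.induction with
  | grade0 r => simpa using scalar r
  | grade1 x =>
    cases x with
    | u i j => exact u i j
    | F i => exact F i
  | mul x y hx hy => simpa using mul _ _ hx hy
  | add x y hx hy => simpa using add _ _ hx hy

theorem minus_induction {p : YMinus R → Prop} (scalar : ∀ r : K, p (algebraMap K _ r))
    (t : ∀ i j, p (t R i j)) (E : ∀ i, p (E R i)) (add : ∀ x y, p x → p y → p (x + y))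
    (mul : ∀ x y, p x → p y → p (x * y)) (x : YMinus R) : p x := by
  obtain ⟨x, rfl⟩ : ∃ y, minusMk R y = x := RingQuot.mkAlgHom_surjective K (MinusRel R) x
  induction x using FreeAlgebra.induction with
  | grade0 r => simpa using scalar r
  | grade1 x =>
    cases x with
    | t i j => exact t i j
    | E i => exact E i
  | mul x y hx hy => simpa using mul _ _ hx hy
  | add x y hx hy => simpa using add _ _ hx hy

variable [DecidableEq ι]

theorem comul_t (i j : ι) :
    Coalgebra.comul (R := K) (t R i j) = ∑ p, t R i p ⊗ₜ[K] t R p j := minusComul_t R i j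

theorem comul_E (i : ι) :
    Coalgebra.comul (R := K) (E R i) = ∑ p, E R p ⊗ₜ[K] t R p i + 1 ⊗ₜ[K] E R i :=
  minusComul_E R i

theorem counit_t (i j : ι) :
    Coalgebra.counit (R := K) (t R i j) = if i = j then 1 else 0 := minusCounit_t R i j

theorem counit_E (i : ι) : Coalgebra.counit (R := K) (E R i) = 0 := minusCounit_E R i

theorem comul_u (i j : ι) :
    Coalgebra.comul (R := K) (u R i j) = ∑ p, u R i p ⊗ₜ[K] u R p j := plusComul_u R i j

theorem comul_F (i : ι) :
    Coalgebra.comul (R := K) (F R i) = F R i ⊗ₜ[K] 1 + ∑ p, u R i p ⊗ₜ[K] F R p :=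
  plusComul_F R i

theorem counit_u (i j : ι) :
    Coalgebra.counit (R := K) (u R i j) = if i = j then 1 else 0 := plusCounit_u R i j

theorem counit_F (i : ι) : Coalgebra.counit (R := K) (F R i) = 0 := plusCounit_F R i

end Basics

/-! ### Existence of the pairing: representations of `Y₊` and their intertwiner. -/

section Existence

variable {K ι : Type*} [Field K] [Fintype ι] [DecidableEq ι]

/-- The matrices of the representation `⟨·, T⟩` of `Y₊` at the generators. -/
def pairTGen (R : Matrix (ι × ι) (ι × ι) K) : PlusGen ι → Matrix ι ι K
  | .u i j => Matrix.of fun k l => R (i, k) (j, l)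
  | .F _ => 0

/-- The matrices of the block triangular representation of `Y₊` with diagonal blocks `ε` and
`⟨·, T⟩` and upper right block `⟨·, E⟩`, at the generators. -/
def pairETGen (R : Matrix (ι × ι) (ι × ι) K) : PlusGen ι → Matrix (Option ι) (Option ι) K
  | .u i j => Matrix.of fun
    | none, none => if i = j then 1 else 0
    | some k, some l => R (i, k) (j, l)
    | _, _ => 0
  | .F i => Matrix.of fun
    | none, some j => if i = j then 1 else 0
    | _, _ => 0

variable {R : Matrix (ι × ι) (ι × ι) K}

omit [DecidableEq ι] in
theorem sum3_rotate {M : Type*} [AddCommMonoid M] (f : ι → ι → ι → M) :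
    ∑ a, ∑ b, ∑ c, f a b c = ∑ b, ∑ c, ∑ a, f a b c := by
  rw [Finset.sum_comm]
  exact Finset.sum_congr rfl fun b _ => Finset.sum_comm

theorem YangBaxterEq.sum_eq (hYB : YangBaxterEq R) (i j k l m n : ι) :
    ∑ a, ∑ b, ∑ c, R (i, j) (a, b) * R (a, k) (l, c) * R (b, c) (m, n) =
      ∑ a, ∑ b, ∑ c, R (j, k) (b, c) * R (i, c) (a, n) * R (a, b) (l, m) := by
  have h := congrFun₂ hYB (i, j, k) (l, m, n)
  simp only [leg12, leg13, leg23, Matrix.mul_apply, Matrix.of_apply, Fintype.sum_prod_type,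
    ite_mul, mul_ite, zero_mul, mul_zero, Finset.sum_mul, Finset.sum_ite_eq, Finset.sum_ite_eq',
    Finset.mem_univ, if_true, Finset.sum_ite_irrel, Finset.sum_const_zero] at h
  exact (sum3_rotate _).trans h

variable (hYB : YangBaxterEq R)

/-- The representation `⟨·, T⟩` of `Y₊`. -/
noncomputable def pairT (hYB : YangBaxterEq R) : YPlus R →ₐ[K] Matrix ι ι K :=
  plusLift (pairTGen R)
    (by
      intro i j k l
      ext m n
      simpa [pairTGen, Matrix.sum_apply, Matrix.mul_apply, Finset.mul_sum, mul_assoc, mul_comm,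
          mul_left_comm]
        using hYB.sum_eq i j m k l n)
    (by simp [pairTGen])

/-- The representation of `Y₊` with diagonal blocks `ε`, `⟨·, T⟩` and upper right block
`⟨·, E⟩`. -/
noncomputable def pairET (hYB : YangBaxterEq R) : YPlus R →ₐ[K] Matrix (Option ι) (Option ι) K :=
  plusLift (pairETGen R)
    (by
      intro i j k l
      ext (_ | m) (_ | n)
      · simp [pairETGen, Matrix.sum_apply, Matrix.mul_apply]
      · simp [pairETGen, Matrix.sum_apply, Matrix.mul_apply]
      · simp [pairETGen, Matrix.sum_apply, Matrix.mul_apply]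
      · simpa [pairETGen, Matrix.sum_apply, Matrix.mul_apply, Finset.mul_sum, mul_assoc, mul_comm,
            mul_left_comm]
          using hYB.sum_eq i j m k l n)
    (by
      intro i j k
      ext (_ | m) (_ | n) <;>
      simp [pairETGen, Matrix.sum_apply, Matrix.mul_apply])

theorem pairT_u (i j k l : ι) : pairT hYB (u R i j) k l = R (i, k) (j, l) := by
  rw [pairT, u, plusLift_mk]
  rfl

theorem pairT_F (i : ι) : pairT hYB (F R i) = 0 := plusLift_mk _ _ _ _

theorem pairET_u (i j : ι) : pairET hYB (u R i j) = pairETGen R (.u i j) := plusLift_mk _ _ _ _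

theorem pairET_F (i : ι) : pairET hYB (F R i) = pairETGen R (.F i) := plusLift_mk _ _ _ _

/-- Block triangular matrices multiply blockwise on the diagonal, so generators suffice. The upper
right block stays free: it is ⟨·, E⟩. -/
theorem pairET_blocks (x : YPlus R) :
    (pairET hYB x none none = Coalgebra.counit (R := K) x) ∧
    (∀ k, pairET hYB x (some k) none = 0) ∧
    ∀ k l, pairET hYB x (some k) (some l) = pairT hYB x k l := by
  induction x using plus_induction with
  | scalar r => simp [Matrix.algebraMap_matrix_apply]
  | u i j => simp [pairET_u, pairETGen, counit_u, pairT_u]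
  | F i => simp [pairET_F, pairETGen, counit_F, pairT_F]
  | add x y hx hy => simp [hx, hy]
  | mul x y hx hy => simp [Matrix.mul_apply, hx, hy]

theorem pairET_none_none (x : YPlus R) :
    pairET hYB x none none = Coalgebra.counit (R := K) x := (pairET_blocks hYB x).1

theorem pairET_some_some (x : YPlus R) (k l : ι) :
    pairET hYB x (some k) (some l) = pairT hYB x k l := (pairET_blocks hYB x).2.2 k l

/-- The matrix `R` extended by the identity on the row and column `none`, as an intertwiner of
the two tensor products of the representations `pairT` and `pairET`. -/
def extR (R : Matrix (ι × ι) (ι × ι) K) : Matrix (Option ι × ι) (ι × Option ι) K :=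
  Matrix.of fun
    | (some i, j), (b, some a) => R (i, j) (a, b)
    | (none, j), (b, none) => if j = b then 1 else 0
    | _, _ => 0

/-- The tensor product of the representations `pairT` and `pairET`. -/
noncomputable def pairTET (hYB : YangBaxterEq R) :
    YPlus R →ₐ[K] Matrix (ι × Option ι) (ι × Option ι) K :=
  (Matrix.kroneckerAlgEquiv ι (Option ι) K).toAlgHom.comp
    ((Algebra.TensorProduct.map (pairT hYB) (pairET hYB)).comp (Bialgebra.comulAlgHom K (YPlus R)))

/-- The tensor product of the representations `pairET` and `pairT`. -/
noncomputable def pairETT (hYB : YangBaxterEq R) :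
    YPlus R →ₐ[K] Matrix (Option ι × ι) (Option ι × ι) K :=
  (Matrix.kroneckerAlgEquiv (Option ι) ι K).toAlgHom.comp
    ((Algebra.TensorProduct.map (pairET hYB) (pairT hYB)).comp (Bialgebra.comulAlgHom K (YPlus R)))

/-- The intertwining property is stable under sums and products in `x`, so it reduces to the
generators. Its entries will be the defining relations of `Y₋`, evaluated at `x`. -/
theorem extR_mul_pairTET (x : YPlus R) :
    extR R * pairTET hYB x = pairETT hYB x * extR R := by
  induction x using plus_induction with
  | scalar r =>
    rw [AlgHom.commutes, AlgHom.commutes, Algebra.algebraMap_eq_smul_one,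
      Algebra.algebraMap_eq_smul_one]
    simp
  | u i j =>
    ext ⟨_ | k, l⟩ ⟨m, _ | n⟩
    iterate 3
      · simp [pairTET, pairETT, comul_u, Matrix.mul_apply, Fintype.sum_prod_type, extR, pairET_u,
          pairETGen, pairT_u, Matrix.sum_apply]
    -- The block without `none` is the Yang–Baxter equation, with `u` on the first leg and the two
    -- representations on the others.
    · have h := hYB.sum_eq i k l j n m
      rw [sum3_rotate] at h
      simp [pairTET, pairETT, comul_u, Matrix.mul_apply, Fintype.sum_prod_type, extR, pairET_u,
        pairETGen, pairT_u, Matrix.sum_apply, Finset.mul_sum, Finset.sum_mul, ← mul_assoc]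
      rw [h, sum3_rotate, sum3_rotate]
      exact Finset.sum_congr rfl fun _ _ => Finset.sum_comm
  | F i =>
    ext ⟨_ | k, l⟩ ⟨m, _ | n⟩ <;>
    simp [pairTET, pairETT, comul_F, Matrix.mul_apply, Fintype.sum_prod_type, extR, pairET_F,
      pairETGen, pairT_F, pairT_u, Matrix.sum_apply, Matrix.one_apply]
  | add x y hx hy => simp only [map_add, Matrix.mul_add, Matrix.add_mul, hx, hy]
  | mul x y hx hy =>
    rw [map_mul, map_mul, ← Matrix.mul_assoc, hx, Matrix.mul_assoc, hy, Matrix.mul_assoc]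

theorem pairTET_apply (x : YPlus R) (i k : ι) (j l : Option ι) :
    pairTET hYB x (i, j) (k, l) = LinearMap.mul' K K (TensorProduct.map
      (Matrix.entryLinearMap K K i k ∘ₗ (pairT hYB).toLinearMap)
      (Matrix.entryLinearMap K K j l ∘ₗ (pairET hYB).toLinearMap) (Coalgebra.comul x)) := by
  rw [← (Coalgebra.Repr.arbitrary K x).eq]
  simp [pairTET, ← (Coalgebra.Repr.arbitrary K x).eq, Matrix.sum_apply]

theorem pairETT_apply (x : YPlus R) (i k : Option ι) (j l : ι) :
    pairETT hYB x (i, j) (k, l) = LinearMap.mul' K K (TensorProduct.map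
      (Matrix.entryLinearMap K K i k ∘ₗ (pairET hYB).toLinearMap)
      (Matrix.entryLinearMap K K j l ∘ₗ (pairT hYB).toLinearMap) (Coalgebra.comul x)) := by
  rw [← (Coalgebra.Repr.arbitrary K x).eq]
  simp [pairETT, ← (Coalgebra.Repr.arbitrary K x).eq, Matrix.sum_apply]

/-- The functionals `⟨·, T⟩` and `⟨·, E⟩` on `Y₊`. -/
noncomputable def pairGen (hYB : YangBaxterEq R) : MinusGen ι → (YPlus R →ₗ[K] K)
  | .t k l => Matrix.entryLinearMap K K k l ∘ₗ (pairT hYB).toLinearMap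
  | .E k => Matrix.entryLinearMap K K none (some k) ∘ₗ (pairET hYB).toLinearMap

theorem entry_comp_pairET_some_some (k l : ι) :
    Matrix.entryLinearMap K K (some k) (some l) ∘ₗ (pairET hYB).toLinearMap =
      pairGen hYB (.t k l) := by
  ext x
  exact pairET_some_some hYB x k l

/-- The map `a ↦ ⟨·, a⟩` from `Y₋` to the opposite of the convolution algebra of `Y₊`. -/
noncomputable def pairHom (hYB : YangBaxterEq R) :
    YMinus R →ₐ[K] (WithConv (YPlus R →ₗ[K] K))ᵐᵒᵖ :=
  minusLift (fun g => MulOpposite.op (WithConv.toConv (pairGen hYB g)))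
    (by
      intro i j k l
      apply MulOpposite.unop_injective
      ext x
      -- Rows `(some i, j)` of the intertwining identity give the relation for T T; rows `(none,
      -- j)`, used below, give the one for E T.
      have h := congrFun₂ (extR_mul_pairTET hYB x) (some i, j) (l, some k)
      simp only [Matrix.mul_apply, Fintype.sum_prod_type, Fintype.sum_option, pairTET_apply,
        pairETT_apply, entry_comp_pairET_some_some] at h
      rw [Finset.sum_comm]
      simpa [extR, pairGen, mul_comm] using h)
    (by
      intro j k l
      apply MulOpposite.unop_injective
      ext x
      have h := congrFun₂ (extR_mul_pairTET hYB x) (none, j) (l, some k)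
      simp only [Matrix.mul_apply, Fintype.sum_prod_type, Fintype.sum_option, pairTET_apply,
        pairETT_apply] at h
      simpa [extR, pairGen, mul_comm] using h)

/-- The skew pairing of `Y₊` and `Y₋`. -/
noncomputable def pairing (hYB : YangBaxterEq R) : YPlus R →ₗ[K] YMinus R →ₗ[K] K :=
  LinearMap.flip
    ((WithConv.linearEquiv K (YPlus R →ₗ[K] K)).toLinearMap ∘ₗ
      (MulOpposite.opLinearEquiv K).symm.toLinearMap ∘ₗ (pairHom hYB).toLinearMap)

theorem pairing_t (x : YPlus R) (k l : ι) : pairing hYB x (t R k l) = pairT hYB x k l := by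
  simp [pairing, pairHom, t, minusLift_mk, pairGen]

theorem pairing_E (x : YPlus R) (k : ι) :
    pairing hYB x (E R k) = pairET hYB x none (some k) := by
  simp [pairing, pairHom, E, minusLift_mk, pairGen]

theorem pairing_one (x : YPlus R) : pairing hYB x 1 = Coalgebra.counit (R := K) x := by
  simp [pairing]

theorem pairing_mul (x : YPlus R) (a b : YMinus R) : pairing hYB x (b * a) =
    LinearMap.mul' K K (TensorProduct.map ((pairing hYB).flip a) ((pairing hYB).flip b)
      (Coalgebra.comul x)) := by
  simp [pairing]

end Existence

theorem sum4_swap {α β γ δ M : Type*} [AddCommMonoid M] (s : Finset α) (t : Finset β)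
    (u : Finset γ) (v : Finset δ) (f : α → β → γ → δ → M) :
    ∑ x ∈ s, ∑ y ∈ t, ∑ a ∈ u, ∑ b ∈ v, f x y a b =
      ∑ b ∈ v, ∑ a ∈ u, ∑ x ∈ s, ∑ y ∈ t, f x y a b := by
  have h (g : α × β → γ × δ → M) :
      ∑ p ∈ s ×ˢ t, ∑ q ∈ u ×ˢ v, g p q = ∑ q ∈ u ×ˢ v, ∑ p ∈ s ×ˢ t, g p q := Finset.sum_comm
  simp only [Finset.sum_product] at h
  exact (h fun p q => f p.1 p.2 q.1 q.2).trans Finset.sum_comm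

/-! ### Multiplicativity in the first argument, and uniqueness. -/

section Uniqueness

variable {K ι : Type*} [Field K] [Fintype ι] [DecidableEq ι] {R : Matrix (ι × ι) (ι × ι) K}

/-- On generators of `Y₋` this is multiplicativity of `pairT` and `pairET` with the triangular shape
of the latter. It passes to products because both comultiplications are multiplicative; `x` and `y`
vary since Δ splits them. -/
theorem pairing_mul_left (hYB : YangBaxterEq R) (x y : YPlus R) (a : YMinus R) :
    pairing hYB (x * y) a = LinearMap.mul' K K
      (TensorProduct.map (pairing hYB x) (pairing hYB y) (Coalgebra.comul a)) := by
  induction a using minus_induction generalizing x y with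
  | scalar r =>
    simp [Algebra.algebraMap_eq_smul_one, pairing_one, Algebra.TensorProduct.one_def]
  | t i j => simp [comul_t, pairing_t, Matrix.mul_apply]
  | E i =>
    simp [comul_E, pairing_t, pairing_E, pairing_one, Matrix.mul_apply, pairET_none_none,
      pairET_some_some, add_comm]
  | add a b ha hb => simp [ha, hb]
  | mul b a hb ha =>
    rw [pairing_mul, Bialgebra.comul_mul, Bialgebra.comul_mul,
      ← (Coalgebra.Repr.arbitrary K x).eq, ← (Coalgebra.Repr.arbitrary K y).eq,
      ← (Coalgebra.Repr.arbitrary K a).eq, ← (Coalgebra.Repr.arbitrary K b).eq]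
    simp only [Finset.sum_mul_sum, Algebra.TensorProduct.tmul_mul_tmul, map_sum,
      TensorProduct.map_tmul, LinearMap.mul'_apply, LinearMap.flip_apply, ha, hb, pairing_mul,
      ← (Coalgebra.Repr.arbitrary K x).eq, ← (Coalgebra.Repr.arbitrary K y).eq,
      ← (Coalgebra.Repr.arbitrary K a).eq, ← (Coalgebra.Repr.arbitrary K b).eq]
    rw [sum4_swap]
    exact Finset.sum_congr rfl fun _ _ => Finset.sum_congr rfl fun _ _ =>
      Finset.sum_congr rfl fun _ _ => Finset.sum_congr rfl fun _ _ => mul_mul_mul_comm _ _ _ _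

theorem pairing_isSkewPairing (hYB : YangBaxterEq R) : IsSkewPairing R (pairing hYB) where
  mul_left := pairing_mul_left hYB
  mul_right := pairing_mul hYB
  one_left a := by
    induction a using minus_induction with
    | scalar r => simp [Algebra.algebraMap_eq_smul_one, pairing_one]
    | t i j => simp [counit_t, pairing_t, Matrix.one_apply]
    | E i => simp [counit_E, pairing_E]
    | add a b ha hb => simp [ha, hb]
    | mul b a hb ha =>
      simp [pairing_mul, hb, ha, Algebra.TensorProduct.one_def, mul_comm]
  one_right := pairing_one hYB
  u_t i j k l := by simp [pairing_t, pairT_u]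
  F_E i j := by simp [pairing_E, pairET_F, pairETGen]
  u_E i j k := by simp [pairing_E, pairET_u, pairETGen]
  F_t i k l := by simp [pairing_t, pairT_F]

variable {P P' : YPlus R →ₗ[K] YMinus R →ₗ[K] K}

theorem IsSkewPairing.mul_t (hP : IsSkewPairing R P) (x y : YPlus R) (k l : ι) :
    P (x * y) (t R k l) = ∑ p, P x (t R k p) * P y (t R p l) := by
  simp [hP.mul_left, comul_t]

theorem IsSkewPairing.mul_E (hP : IsSkewPairing R P) (x y : YPlus R) (k : ι) :
    P (x * y) (E R k) =
      ∑ p, P x (E R p) * P y (t R p k) + Coalgebra.counit (R := K) x * P y (E R k) := by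
  simp [hP.mul_left, comul_E, hP.one_right]

theorem IsSkewPairing.u_mul (hP : IsSkewPairing R P) (i j : ι) (b a : YMinus R) :
    P (u R i j) (b * a) = ∑ p, P (u R i p) a * P (u R p j) b := by
  simp [hP.mul_right, comul_u]

/-- Δ(T) and Δ(E) involve only T, E and 1, so the induction on `x` closes up on these values. -/
theorem IsSkewPairing.ext_gen (hP : IsSkewPairing R P) (hP' : IsSkewPairing R P') (x : YPlus R) :
    (∀ k l, P x (t R k l) = P' x (t R k l)) ∧ ∀ k, P x (E R k) = P' x (E R k) := by
  induction x using plus_induction with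
  | scalar r => simp [Algebra.algebraMap_eq_smul_one, hP.one_left, hP'.one_left]
  | u i j => simp [hP.u_t, hP'.u_t, hP.u_E, hP'.u_E]
  | F i => simp [hP.F_t, hP'.F_t, hP.F_E, hP'.F_E]
  | add x y hx hy => simp [hx, hy]
  | mul x y hx hy => simp [hP.mul_t, hP'.mul_t, hP.mul_E, hP'.mul_E, hx, hy]

theorem IsSkewPairing.ext (hP : IsSkewPairing R P) (hP' : IsSkewPairing R P') : P = P' := by
  suffices h : ∀ a, P.flip a = P'.flip a by
    ext x a
    exact LinearMap.congr_fun (h a) x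
  intro a
  ext x
  induction a using minus_induction generalizing x with
  | scalar r => simp [Algebra.algebraMap_eq_smul_one, hP.one_right, hP'.one_right]
  | t i j => exact (hP.ext_gen hP' x).1 i j
  | E i => exact (hP.ext_gen hP' x).2 i
  | add a b ha hb => simp [ha, hb]
  | mul b a hb ha =>
    simp only [LinearMap.flip_apply, hP.mul_right, hP'.mul_right, LinearMap.ext ha,
      LinearMap.ext hb]

theorem existsUnique_isSkewPairing (hYB : YangBaxterEq R) : ∃! P, IsSkewPairing R P :=
  ⟨pairing hYB, pairing_isSkewPairing hYB, fun _ h => h.ext (pairing_isSkewPairing hYB)⟩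

end Uniqueness

/-! ### Recursion for the braided integers. -/

section BraidedInt

variable {K ι : Type*} [Field K] [Fintype ι] [DecidableEq ι] {R : Matrix (ι × ι) (ι × ι) K}

omit [Fintype ι] in
theorem oneTensor_one {N : ℕ} :
    oneTensor (1 : Matrix (Fin N → ι) (Fin N → ι) K) = 1 := by
  ext q a
  simp only [oneTensor, Matrix.of_apply, Matrix.one_apply, ← ite_and]
  congr 1
  rw [← Fin.cons_self_tail q, ← Fin.cons_self_tail a, Fin.cons_inj]
  simp

omit [DecidableEq ι] in
theorem sum_pi_succ {N : ℕ} {M : Type*} [AddCommMonoid M] (f : (Fin (N + 1) → ι) → M) :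
    ∑ a, f a = ∑ i, ∑ b, f (Fin.cons i b) := by
  rw [← (Fin.consEquiv fun _ => ι).sum_comp, Fintype.sum_prod_type]
  rfl

theorem oneTensor_mul {N : ℕ} (A B : Matrix (Fin N → ι) (Fin N → ι) K) :
    oneTensor (A * B) = oneTensor A * oneTensor B := by
  ext q a
  simp [oneTensor, Matrix.mul_apply, sum_pi_succ]

omit [Fintype ι] in
theorem oneTensor_braidAt {N : ℕ} (m : Fin N) :
    oneTensor (braidAt R m) = braidAt R m.succ := by
  ext q a
  simp only [oneTensor, braidAt, Matrix.of_apply, Fin.forall_fin_succ (n := N + 1), ← ite_and]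
  congr 1
  simp [Fin.tail, Fin.ext_iff]

omit [Fintype ι] in
theorem oneTensor_sum {N : ℕ} {α : Type*} (s : Finset α)
    (A : α → Matrix (Fin N → ι) (Fin N → ι) K) :
    oneTensor (∑ i ∈ s, A i) = ∑ i ∈ s, oneTensor (A i) := by
  ext q a
  simp [oneTensor, Matrix.sum_apply, Finset.sum_ite_irrel]

theorem oneTensor_list_prod {N : ℕ} (l : List (Matrix (Fin N → ι) (Fin N → ι) K)) :
    oneTensor l.prod = (l.map oneTensor).prod := by
  induction l with
  | nil => simp [oneTensor_one]
  | cons A l h => simp [oneTensor_mul, h]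

theorem braidedInt_zero : braidedInt R 0 = 1 := by simp [braidedInt]

/-- Every summand except the empty product begins with B₁, and the rest of it is a summand of the
previous braided integer shifted by one factor. -/
theorem braidedInt_succ (N : ℕ) :
    braidedInt R (N + 1) = 1 + braidAt R 0 * oneTensor (braidedInt R N) := by
  rw [braidedInt, Finset.sum_range_succ', braidedInt, oneTensor_sum, Finset.mul_sum]
  refine (add_comm _ _).trans ?_
  simp only [List.take_zero, List.map_nil, List.prod_nil]
  congr 1
  refine Finset.sum_congr rfl fun k _ => ?_
  rw [List.finRange_succ, List.take_succ_cons, List.map_cons, List.prod_cons,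
    oneTensor_list_prod, ← List.map_take, List.map_map, List.map_map]
  simp only [Function.comp_def, oneTensor_braidAt]

omit [Fintype ι] in
theorem braidAt_zero_cons {N : ℕ} (b e : Fin N → ι) (c d k l : ι) :
    braidAt R (0 : Fin (N + 1)) (Fin.cons d (Fin.cons c b)) (Fin.cons k (Fin.cons l e)) =
      if b = e then R (c, d) (k, l) else 0 := by
  rw [braidAt, Matrix.of_apply]
  congr 1
  · rw [Fin.forall_fin_succ, Fin.forall_fin_succ]
    simp [funext_iff, Fin.ext_iff]

/-- Only the second intermediate index `l` is free: `oneTensor` fixes the first one and B₁ those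
from the third on. The order `(b 1, b 0)` is the flip in `braidMatrix`. -/
theorem braidedInt_succ_apply {N : ℕ} (b a : Fin (N + 2) → ι) :
    braidedInt R (N + 1) b a = (if b = a then 1 else 0) +
      ∑ l, R (b 1, b 0) (a 0, l) *
        braidedInt R N (Fin.cons l (Fin.tail (Fin.tail b))) (Fin.tail a) := by
  obtain ⟨d, b, rfl⟩ : ∃ d b', b = Fin.cons d b' := ⟨_, _, (Fin.cons_self_tail b).symm⟩
  obtain ⟨c, b, rfl⟩ : ∃ c b', b = Fin.cons c b' := ⟨_, _, (Fin.cons_self_tail b).symm⟩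
  rw [braidedInt_succ, Matrix.add_apply, Matrix.one_apply, Matrix.mul_apply, sum_pi_succ]
  simp_rw [sum_pi_succ (N := N), braidAt_zero_cons]
  simp [oneTensor]

end BraidedInt

/-! ### Convolution of functionals on a coalgebra. -/

section Conv

variable {K C : Type*} [Field K] [AddCommGroup C] [Module K C] [Coalgebra K C]

/-- The convolution product of functionals on a coalgebra, as a bilinear map. -/
noncomputable def conv : (C →ₗ[K] K) →ₗ[K] (C →ₗ[K] K) →ₗ[K] (C →ₗ[K] K) :=
  LinearMap.mk₂ K
    (fun f g => LinearMap.mul' K K ∘ₗ TensorProduct.map f g ∘ₗ Coalgebra.comul)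
    (by intro f g h; ext; simp [TensorProduct.map_add_left])
    (by intro c f g; ext; simp [TensorProduct.map_smul_left])
    (by intro f g h; ext; simp [TensorProduct.map_add_right])
    (by intro c f g; ext; simp [TensorProduct.map_smul_right])

theorem conv_apply (f g : C →ₗ[K] K) (x : C) :
    conv f g x = LinearMap.mul' K K (TensorProduct.map f g (Coalgebra.comul x)) := rfl

end Conv

/-! ### Pairing words in F with words in E. -/

section Words

variable {K ι : Type*} [Field K] [Fintype ι] [DecidableEq ι] {R : Matrix (ι × ι) (ι × ι) K}
  {P : YPlus R →ₗ[K] YMinus R →ₗ[K] K}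

omit [DecidableEq ι]

theorem wordE_zero (a : Fin 0 → ι) : wordE R a = 1 := by simp [wordE]

theorem wordF_zero (a : Fin 0 → ι) : wordF R a = 1 := by simp [wordF]

theorem wordE_succ {N : ℕ} (a : Fin (N + 1) → ι) :
    wordE R a = E R (a 0) * wordE R (Fin.tail a) := by
  simp [wordE, List.ofFn_succ, Fin.tail]

theorem wordF_succ {N : ℕ} (a : Fin (N + 1) → ι) :
    wordF R a = F R (a 0) * wordF R (Fin.tail a) := by
  simp [wordF, List.ofFn_succ, Fin.tail]

theorem wordE_cons {N : ℕ} (i : ι) (a : Fin N → ι) :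
    wordE R (Fin.cons i a : Fin (N + 1) → ι) = E R i * wordE R a := by
  simp [wordE_succ]

variable [DecidableEq ι]

theorem IsSkewPairing.flip_mul (hP : IsSkewPairing R P) (b a : YMinus R) :
    P.flip (b * a) = conv (P.flip a) (P.flip b) := by
  ext x
  simp [hP.mul_right, conv_apply]

theorem conv_comp_mulLeft_u (f g : YPlus R →ₗ[K] K) (i j : ι) :
    conv f g ∘ₗ LinearMap.mulLeft K (u R i j) =
      ∑ p, conv (f ∘ₗ LinearMap.mulLeft K (u R i p)) (g ∘ₗ LinearMap.mulLeft K (u R p j)) := by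
  ext x
  simp only [LinearMap.comp_apply, conv_apply, LinearMap.mulLeft_apply, LinearMap.sum_apply]
  rw [Bialgebra.comul_mul, comul_u, ← (Coalgebra.Repr.arbitrary K x).eq]
  simp only [Finset.sum_mul_sum, map_sum, Algebra.TensorProduct.tmul_mul_tmul]
  simp

theorem conv_comp_mulLeft_F (f g : YPlus R →ₗ[K] K) (i : ι) :
    conv f g ∘ₗ LinearMap.mulLeft K (F R i) = conv (f ∘ₗ LinearMap.mulLeft K (F R i)) g +
      ∑ p, conv (f ∘ₗ LinearMap.mulLeft K (u R i p)) (g ∘ₗ LinearMap.mulLeft K (F R p)) := by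
  ext x
  simp only [LinearMap.comp_apply, conv_apply, LinearMap.mulLeft_apply, LinearMap.sum_apply,
    LinearMap.add_apply]
  rw [Bialgebra.comul_mul, comul_F, ← (Coalgebra.Repr.arbitrary K x).eq]
  simp only [add_mul, Finset.sum_mul, Finset.mul_sum, map_add, map_sum,
    Algebra.TensorProduct.tmul_mul_tmul, Finset.sum_add_distrib]
  rw [Finset.sum_comm (s := Finset.univ)]
  simp

theorem IsSkewPairing.flip_E_mulLeft_u (hP : IsSkewPairing R P) (i j k : ι) :
    P.flip (E R k) ∘ₗ LinearMap.mulLeft K (u R i j) = if i = j then P.flip (E R k) else 0 := by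
  ext x
  split_ifs with h <;> simp [hP.mul_E, hP.u_E, counit_u, h]

theorem IsSkewPairing.flip_E_mulLeft_F (hP : IsSkewPairing R P) (i k : ι) :
    P.flip (E R k) ∘ₗ LinearMap.mulLeft K (F R i) = P.flip (t R i k) := by
  ext x
  simp [hP.mul_E, hP.F_E, counit_F]

/-- U acts on each letter E through ε because ⟨U, E⟩ = 0, and Δ(U) = U ⊗ U carries this to words. -/
theorem IsSkewPairing.flip_wordE_mulLeft_u (hP : IsSkewPairing R P) (i j : ι) {N : ℕ}
    (a : Fin N → ι) : P.flip (wordE R a) ∘ₗ LinearMap.mulLeft K (u R i j) =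
      if i = j then P.flip (wordE R a) else 0 := by
  induction N generalizing i j with
  | zero =>
    ext x
    split_ifs with h <;> simp [wordE_zero, hP.one_right, counit_u, h]
  | succ N ih =>
    rw [wordE_succ, hP.flip_mul, conv_comp_mulLeft_u, Finset.sum_eq_single i]
    · rw [ih, hP.flip_E_mulLeft_u, if_pos rfl]
      split_ifs <;> simp
    · intro p _ hp
      simp [ih, hp.symm]
    · simp

omit [DecidableEq ι] in
theorem E_mul_t_mul (j k l : ι) (y : YMinus R) : E R k * (t R j l * y) =
    ∑ c, ∑ d, R (c, d) (k, l) • (t R j d * (E R c * y)) := by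
  simp [← mul_assoc, ET, Finset.sum_mul]

/-- Pairing with `F^q` on the left acts on words in the `E_i` as a braided derivation. -/
theorem IsSkewPairing.F_mul_wordE (hP : IsSkewPairing R P) (q : ι) (x : YPlus R) {N : ℕ}
    (a : Fin (N + 1) → ι) : P (F R q * x) (wordE R a) =
      ∑ b, braidedInt R N b a * P x (t R q (b 0) * wordE R (Fin.tail b)) := by
  induction N generalizing q x with
  | zero =>
    have h := LinearMap.congr_fun (hP.flip_E_mulLeft_F q (a 0)) x
    simpa [wordE_succ, wordE_zero, braidedInt_zero, Matrix.one_apply] using h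
  | succ N ih =>
    have ih' : P.flip (wordE R (Fin.tail a)) ∘ₗ LinearMap.mulLeft K (F R q) =
        ∑ b, braidedInt R N b (Fin.tail a) • P.flip (t R q (b 0) * wordE R (Fin.tail b)) := by
      ext x
      simpa using ih q x (Fin.tail a)
    have h : P.flip (wordE R a) ∘ₗ LinearMap.mulLeft K (F R q) =
        P.flip (t R q (a 0) * wordE R (Fin.tail a)) +
        ∑ b, braidedInt R N b (Fin.tail a) •
          P.flip (E R (a 0) * (t R q (b 0) * wordE R (Fin.tail b))) := by
      -- In U ⊗ F the factor u^q_p meets the tail through δ, so only p = q survives, and there F^q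
      -- turns the first letter into t. In F ⊗ 1 the induction hypothesis applies to the tail.
      rw [wordE_succ, hP.flip_mul, conv_comp_mulLeft_F, ih', add_comm, Finset.sum_eq_single q]
      · simp [hP.flip_E_mulLeft_F, hP.flip_wordE_mulLeft_u, hP.flip_mul, -LinearMap.flip_apply]
      · intro p _ hp
        simp [hP.flip_wordE_mulLeft_u, hp.symm]
      · simp
    have h₁ : P (F R q * x) (wordE R a) =
        P x (t R q (a 0) * wordE R (Fin.tail a)) +
        ∑ b, braidedInt R N b (Fin.tail a) *
          P x (E R (a 0) * (t R q (b 0) * wordE R (Fin.tail b))) := by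
      simpa using LinearMap.congr_fun h x
    rw [h₁]
    simp_rw [braidedInt_succ_apply, add_mul, Finset.sum_add_distrib]
    congr 1
    · simp
    · rw [sum_pi_succ, sum_pi_succ]
      simp_rw [sum_pi_succ (N := N)]
      -- Moving the first E past t produces the R of the factor B₁ in `braidedInt_succ_apply`.
      simp [E_mul_t_mul, wordE_cons, Finset.mul_sum, Finset.sum_mul]
      rw [sum4_swap]
      refine Finset.sum_congr rfl fun d _ => Finset.sum_congr rfl fun c _ => ?_
      rw [Finset.sum_comm]
      refine Finset.sum_congr rfl fun w _ => Finset.sum_congr rfl fun l _ => ?_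
      ring

theorem IsSkewPairing.flip_t_mulLeft_F (hP : IsSkewPairing R P) (i j k : ι) :
    P.flip (t R j k) ∘ₗ LinearMap.mulLeft K (F R i) = 0 := by
  ext x
  simp [hP.mul_t, hP.F_t]

/-- Since ⟨F x, T⟩ = 0, only F ⊗ 1 contributes from each Δ(F). Every letter thus lands in the left
factor, where it is absorbed into `f`. -/
theorem IsSkewPairing.conv_flip_t_wordF (hP : IsSkewPairing R P) (f : YPlus R →ₗ[K] K)
    (j k : ι) {N : ℕ} (q : Fin N → ι) :
    conv f (P.flip (t R j k)) (wordF R q) = (if j = k then 1 else 0) * f (wordF R q) := by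
  induction N generalizing f with
  | zero =>
    simp [conv_apply, wordF_zero, Algebra.TensorProduct.one_def, hP.one_left, counit_t, mul_comm]
  | succ N ih =>
    have h := LinearMap.congr_fun (conv_comp_mulLeft_F f (P.flip (t R j k)) (q 0))
      (wordF R (Fin.tail q))
    rw [wordF_succ]
    simpa [hP.flip_t_mulLeft_F, ih] using h

theorem IsSkewPairing.wordF_t_mul (hP : IsSkewPairing R P) (j k : ι) {N : ℕ} (q : Fin N → ι)
    (y : YMinus R) :
    P (wordF R q) (t R j k * y) = (if j = k then 1 else 0) * P (wordF R q) y := by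
  rw [← LinearMap.flip_apply, hP.flip_mul, hP.conv_flip_t_wordF, LinearMap.flip_apply]

theorem IsSkewPairing.wordF_wordE (hP : IsSkewPairing R P) {N : ℕ} (q a : Fin N → ι) :
    P (wordF R q) (wordE R a) = braidedFactorial R N q a := by
  induction N with
  | zero => simp [wordF_zero, wordE_zero, hP.one_left, braidedFactorial, Matrix.one_apply,
      Subsingleton.elim q a]
  | succ N ih =>
    rw [wordF_succ, hP.F_mul_wordE, braidedFactorial, Matrix.mul_apply]
    refine Finset.sum_congr rfl fun b _ => ?_
    rw [hP.wordF_t_mul, ih]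
    simp [oneTensor, mul_comm]

/-- Each F uses up exactly one E; when one word runs out, ε kills what remains of the other. -/
theorem IsSkewPairing.wordF_wordE_of_ne (hP : IsSkewPairing R P) {M N : ℕ} (h : M ≠ N)
    (q : Fin M → ι) (a : Fin N → ι) : P (wordF R q) (wordE R a) = 0 := by
  induction M generalizing N with
  | zero =>
    obtain ⟨N, rfl⟩ := Nat.exists_eq_succ_of_ne_zero h.symm
    simp [wordF_zero, hP.one_left, wordE_succ, counit_E]
  | succ M ih =>
    cases N with
    | zero => simp [wordE_zero, hP.one_right, wordF_succ, counit_F]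
    | succ N =>
      rw [wordF_succ, hP.F_mul_wordE]
      refine Finset.sum_eq_zero fun b _ => ?_
      rw [hP.wordF_t_mul, ih (by omega), mul_zero, mul_zero]

end Words

/-! ### Reordering products into a subalgebra element times a word. -/

section Span

variable {K A κ ι : Type*} [Field K] [Ring A] [Algebra K A] {g : κ → A} {f : ι → A}

theorem list_prod_mul_mem_span
    (h : ∀ i k, f i * g k ∈ Submodule.span K (Set.range fun p : κ × ι => g p.1 * f p.2))
    (l : List ι) (k : κ) : (l.map f).prod * g k ∈
      Submodule.span K (Set.range fun p : κ × List ι => g p.1 * (p.2.map f).prod) := by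
  induction l generalizing k with
  | nil => exact Submodule.subset_span ⟨(k, []), by simp⟩
  | cons i l ih =>
    rw [List.map_cons, List.prod_cons, mul_assoc]
    have hz := ih k
    generalize (l.map f).prod * g k = z at hz ⊢
    induction hz using Submodule.span_induction with
    | mem x hx =>
      obtain ⟨⟨k', l'⟩, rfl⟩ := hx
      rw [← mul_assoc]
      have hz := h i k'
      generalize f i * g k' = z at hz ⊢
      induction hz using Submodule.span_induction with
      | mem x hx =>
        obtain ⟨⟨k'', i'⟩, rfl⟩ := hx
        exact Submodule.subset_span ⟨(k'', i' :: l'), by simp [mul_assoc]⟩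
      | zero => simp
      | add x y _ _ hx hy => simpa only [add_mul] using add_mem hx hy
      | smul c x _ hx => simpa only [smul_mul_assoc] using Submodule.smul_mem _ c hx
    | zero => simp
    | add x y _ _ hx hy => simpa only [mul_add] using add_mem hx hy
    | smul c x _ hx => simpa only [mul_smul_comm] using Submodule.smul_mem _ c hx

/-- If each `f i * g k` is a linear combination of the products `g k' * f i'`, then the products
of an element of a subalgebra containing the `g k` and a word in the `f i` span a subspace closed
under multiplication from the right by the `g k` and the `f i`. -/
theorem span_mul_words_mul_mem (B : Subalgebra K A) (hB : ∀ k, g k ∈ B)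
    (h : ∀ i k, f i * g k ∈ Submodule.span K (Set.range fun p : κ × ι => g p.1 * f p.2))
    {x : A} (hx : x ∈ Submodule.span K (Set.range fun p : B × List ι => p.1 * (p.2.map f).prod)) :
    (∀ k, x * g k ∈ Submodule.span K (Set.range fun p : B × List ι => p.1 * (p.2.map f).prod)) ∧
      ∀ i, x * f i ∈ Submodule.span K (Set.range fun p : B × List ι => p.1 * (p.2.map f).prod) := by
  induction hx using Submodule.span_induction with
  | mem x hx =>
    obtain ⟨⟨b, l⟩, rfl⟩ := hx
    refine ⟨fun k => ?_, fun i => Submodule.subset_span ⟨(b, l ++ [i]), by simp [mul_assoc]⟩⟩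
    rw [mul_assoc]
    have hz := list_prod_mul_mem_span h l k
    generalize (l.map f).prod * g k = z at hz ⊢
    induction hz using Submodule.span_induction with
    | mem x hx =>
      obtain ⟨⟨k', l'⟩, rfl⟩ := hx
      exact Submodule.subset_span ⟨(b * ⟨g k', hB k'⟩, l'), by simp [mul_assoc]⟩
    | zero => simp
    | add x y _ _ hx hy => simpa only [mul_add] using add_mem hx hy
    | smul c x _ hx => simpa only [mul_smul_comm] using Submodule.smul_mem _ c hx
  | zero => simp
  | add x y _ _ hx hy =>
    simp only [add_mul]
    exact ⟨fun k => add_mem (hx.1 k) (hy.1 k), fun k => add_mem (hx.2 k) (hy.2 k)⟩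
  | smul c x _ hx =>
    simp only [smul_mul_assoc]
    exact ⟨fun k => Submodule.smul_mem _ c (hx.1 k), fun k => Submodule.smul_mem _ c (hx.2 k)⟩

end Span

/-! ### Spanning sets of `Y₊` and `Y₋`. -/

section Triangular

variable {K ι : Type*} [Field K] [Fintype ι] (R : Matrix (ι × ι) (ι × ι) K)

theorem u_mem_algU (i j : ι) : u R i j ∈ algU R := Algebra.subset_adjoin ⟨i, j, rfl⟩

theorem t_mem_algT (i j : ι) : t R i j ∈ algT R := Algebra.subset_adjoin ⟨i, j, rfl⟩

theorem plus_mem_span (x : YPlus R) : x ∈ Submodule.span K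
    (Set.range fun p : algU R × List ι => p.1 * (p.2.map (F R)).prod) := by
  have key {y : YPlus R} := span_mul_words_mul_mem (K := K) (g := fun p : ι × ι => u R p.1 p.2)
    (f := F R) (x := y) (algU R) (fun p => u_mem_algU R p.1 p.2) (by
      rintro i ⟨k, l⟩
      rw [FU]
      exact Submodule.sum_mem _ fun a _ => Submodule.sum_mem _ fun b _ =>
        Submodule.smul_mem _ _ (Submodule.subset_span ⟨((a, l), b), rfl⟩))
  -- The span is stable under right multiplication by generators, hence by every `x`; it contains 1,
  -- so it is everything.
  suffices h : ∀ y ∈ Submodule.span K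
      (Set.range fun p : algU R × List ι => (p.1 : YPlus R) * (p.2.map (F R)).prod),
      y * x ∈ Submodule.span K
        (Set.range fun p : algU R × List ι => (p.1 : YPlus R) * (p.2.map (F R)).prod) by
    simpa using h 1 (Submodule.subset_span ⟨(1, []), by simp⟩)
  induction x using plus_induction with
  | scalar r =>
    intro y hy
    rw [← Algebra.commutes, ← Algebra.smul_def]
    exact Submodule.smul_mem _ r hy
  | u i j => exact fun y hy => (key hy).1 (i, j)
  | F i => exact fun y hy => (key hy).2 i
  | add x x' hx hx' =>
    intro y hy
    rw [mul_add]
    exact add_mem (hx y hy) (hx' y hy)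
  | mul x x' hx hx' =>
    intro y hy
    rw [← mul_assoc]
    exact hx' _ (hx y hy)

theorem minus_mem_span (x : YMinus R) : x ∈ Submodule.span K
    (Set.range fun p : algT R × List ι => p.1 * (p.2.map (E R)).prod) := by
  have key {y : YMinus R} := span_mul_words_mul_mem (K := K) (g := fun p : ι × ι => t R p.1 p.2)
    (f := E R) (x := y) (algT R) (fun p => t_mem_algT R p.1 p.2) (by
      rintro i ⟨k, l⟩
      rw [ET]
      exact Submodule.sum_mem _ fun a _ => Submodule.sum_mem _ fun b _ =>
        Submodule.smul_mem _ _ (Submodule.subset_span ⟨((k, b), a), rfl⟩))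
  suffices h : ∀ y ∈ Submodule.span K
      (Set.range fun p : algT R × List ι => (p.1 : YMinus R) * (p.2.map (E R)).prod),
      y * x ∈ Submodule.span K
        (Set.range fun p : algT R × List ι => (p.1 : YMinus R) * (p.2.map (E R)).prod) by
    simpa using h 1 (Submodule.subset_span ⟨(1, []), by simp⟩)
  induction x using minus_induction with
  | scalar r =>
    intro y hy
    rw [← Algebra.commutes, ← Algebra.smul_def]
    exact Submodule.smul_mem _ r hy
  | t i j => exact fun y hy => (key hy).1 (i, j)
  | E i => exact fun y hy => (key hy).2 i
  | add x x' hx hx' =>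
    intro y hy
    rw [mul_add]
    exact add_mem (hx y hy) (hx' y hy)
  | mul x x' hx hx' =>
    intro y hy
    rw [← mul_assoc]
    exact hx' _ (hx y hy)

variable {R}

theorem plus_functional_eq_zero {f : YPlus R →ₗ[K] K}
    (h : ∀ X ∈ algU R, ∀ l : List ι, f (X * (l.map (F R)).prod) = 0) : f = 0 := by
  ext x
  have := Submodule.span_le (p := LinearMap.ker f).2
    (by rintro _ ⟨⟨X, l⟩, rfl⟩; exact h X X.2 l) (plus_mem_span R x)
  simpa using this

theorem minus_functional_eq_zero {f : YMinus R →ₗ[K] K}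
    (h : ∀ T ∈ algT R, ∀ l : List ι, f (T * (l.map (E R)).prod) = 0) : f = 0 := by
  ext x
  have := Submodule.span_le (p := LinearMap.ker f).2
    (by rintro _ ⟨⟨X, l⟩, rfl⟩; exact h X X.2 l) (minus_mem_span R x)
  simpa using this

theorem wordF_get (l : List ι) : wordF R l.get = (l.map (F R)).prod := by
  rw [wordF, ← Function.comp_def (F R) l.get, ← List.map_ofFn, List.ofFn_get]

theorem wordE_get (l : List ι) : wordE R l.get = (l.map (E R)).prod := by
  rw [wordE, ← Function.comp_def (E R) l.get, ← List.map_ofFn, List.ofFn_get]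

end Triangular

/-! ### Null ideals and descent to the quotients. -/

section Null

variable {K ι : Type*} [Field K] [Fintype ι] [DecidableEq ι] {R : Matrix (ι × ι) (ι × ι) K}
  {P : YPlus R →ₗ[K] YMinus R →ₗ[K] K}

theorem IsSkewPairing.algU_mul_wordE (hP : IsSkewPairing R P) {X : YPlus R} (hX : X ∈ algU R)
    (x : YPlus R) {N : ℕ} (a : Fin N → ι) :
    P (X * x) (wordE R a) = Coalgebra.counit (R := K) X * P x (wordE R a) := by
  induction hX using Algebra.adjoin_induction generalizing x with
  | mem X hX =>
    obtain ⟨i, j, rfl⟩ := hX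
    have h := LinearMap.congr_fun (hP.flip_wordE_mulLeft_u i j a) x
    rw [LinearMap.comp_apply, LinearMap.mulLeft_apply, LinearMap.flip_apply] at h
    rw [h, counit_u]
    split_ifs <;> simp
  | algebraMap r => simp [Algebra.algebraMap_eq_smul_one]
  | add X Y _ _ hX hY => simp [add_mul, hX, hY]
  | mul X Y _ _ hX hY => simp [mul_assoc, hX, hY]

theorem IsSkewPairing.wordF_algT_mul (hP : IsSkewPairing R P) {T : YMinus R} (hT : T ∈ algT R)
    (y : YMinus R) {N : ℕ} (q : Fin N → ι) :
    P (wordF R q) (T * y) = Coalgebra.counit (R := K) T * P (wordF R q) y := by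
  induction hT using Algebra.adjoin_induction generalizing y with
  | mem T hT =>
    obtain ⟨i, j, rfl⟩ := hT
    rw [hP.wordF_t_mul, counit_t]
  | algebraMap r => simp [Algebra.algebraMap_eq_smul_one]
  | add X Y _ _ hX hY => simp [add_mul, hX, hY]
  | mul X Y _ _ hX hY => simp [mul_assoc, hX, hY]

/-- It suffices to test against X · (F-word): X factors out as ε(X), and only F-words of length `N`
can pair nontrivially. -/
theorem IsSkewPairing.sum_wordE_null_iff (hP : IsSkewPairing R P) {N : ℕ} (ω : (Fin N → ι) → K) :
    (∀ x, P x (∑ a, ω a • wordE R a) = 0) ↔ (braidedFactorial R N).mulVec ω = 0 := by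
  have hw (q : Fin N → ι) : P (wordF R q) (∑ a, ω a • wordE R a) =
      (braidedFactorial R N).mulVec ω q := by
    simp [hP.wordF_wordE, Matrix.mulVec, dotProduct, mul_comm]
  refine ⟨fun h => funext fun q => by rw [← hw, h]; rfl, fun h => ?_⟩
  suffices h' : P.flip (∑ a, ω a • wordE R a) = 0 from fun x => LinearMap.congr_fun h' x
  refine plus_functional_eq_zero fun X hX l => ?_
  have hl : P (wordF R l.get) (∑ a, ω a • wordE R a) = 0 := by
    by_cases hN : l.length = N
    · subst hN
      rw [hw, h]
      rfl
    · simp [hP.wordF_wordE_of_ne hN]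
  simp only [map_sum, map_smul, smul_eq_mul] at hl
  rw [← wordF_get, LinearMap.flip_apply]
  simp only [map_sum, map_smul, smul_eq_mul, hP.algU_mul_wordE hX,
    mul_left_comm _ (Coalgebra.counit (R := K) X), ← Finset.mul_sum, hl, mul_zero]

theorem IsSkewPairing.sum_wordF_null_iff (hP : IsSkewPairing R P) {N : ℕ} (η : (Fin N → ι) → K) :
    (∀ y, P (∑ a, η a • wordF R a) y = 0) ↔ Matrix.vecMul η (braidedFactorial R N) = 0 := by
  have hw (q : Fin N → ι) : P (∑ a, η a • wordF R a) (wordE R q) =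
      Matrix.vecMul η (braidedFactorial R N) q := by
    simp [hP.wordF_wordE, Matrix.vecMul, dotProduct]
  refine ⟨fun h => funext fun q => by rw [← hw, h]; rfl, fun h => ?_⟩
  suffices h' : P (∑ a, η a • wordF R a) = 0 from fun x => LinearMap.congr_fun h' x
  refine minus_functional_eq_zero fun T hT l => ?_
  have hl : P (∑ a, η a • wordF R a) (wordE R l.get) = 0 := by
    by_cases hN : l.length = N
    · subst hN
      rw [hw, h]
      rfl
    · simp [hP.wordF_wordE_of_ne (Ne.symm hN)]
  simp only [map_sum, map_smul, LinearMap.sum_apply, LinearMap.smul_apply, smul_eq_mul] at hl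
  simp only [← wordE_get, map_sum, map_smul, LinearMap.sum_apply, LinearMap.smul_apply,
    smul_eq_mul, hP.wordF_algT_mul hT, mul_left_comm _ (Coalgebra.counit (R := K) T),
    ← Finset.mul_sum, hl, mul_zero]

theorem IsSkewPairing.mul_F_algT (hP : IsSkewPairing R P) {a : YMinus R} (ha : a ∈ algT R)
    (i : ι) (x : YPlus R) : P (x * F R i) a = 0 := by
  -- All indices are treated at once because Δ(F^i) involves every F^p. In each term of Δ(x F^i) one
  -- tensor factor again ends in an F, so vanishing passes to products in `algT R`.
  suffices h : ∀ i, P.flip a ∘ₗ LinearMap.mulRight K (F R i) = 0 from LinearMap.congr_fun (h i) x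
  clear x i
  induction ha using Algebra.adjoin_induction with
  | mem a ha =>
    obtain ⟨k, l, rfl⟩ := ha
    intro i
    ext x
    simp [hP.mul_t, hP.F_t]
  | algebraMap r =>
    intro i
    ext x
    simp [Algebra.algebraMap_eq_smul_one, hP.one_right, counit_F]
  | add a b _ _ ha hb =>
    intro i
    rw [map_add, LinearMap.add_comp, ha, hb, add_zero]
  | mul b a _ _ hb ha =>
    intro i
    ext x
    have ha' (y : YPlus R) (j : ι) : P (y * F R j) a = 0 := LinearMap.congr_fun (ha j) y
    have hb' (y : YPlus R) (j : ι) : P (y * F R j) b = 0 := LinearMap.congr_fun (hb j) y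
    rw [LinearMap.comp_apply, LinearMap.mulRight_apply, LinearMap.flip_apply, hP.mul_right,
      Bialgebra.comul_mul, comul_F, ← (Coalgebra.Repr.arbitrary K x).eq]
    simp [mul_add, Finset.sum_mul, Finset.mul_sum, ha', hb']

theorem IsSkewPairing.algU_mul_E (hP : IsSkewPairing R P) {x : YPlus R} (hx : x ∈ algU R)
    (i : ι) (a : YMinus R) : P x (a * E R i) = 0 := by
  suffices h : ∀ i, P x ∘ₗ LinearMap.mulRight K (E R i) = 0 from LinearMap.congr_fun (h i) a
  clear a i
  induction hx using Algebra.adjoin_induction with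
  | mem a ha =>
    obtain ⟨k, l, rfl⟩ := ha
    intro i
    ext x
    simp [hP.u_mul, hP.u_E]
  | algebraMap r =>
    intro i
    ext x
    simp [Algebra.algebraMap_eq_smul_one, hP.one_left, counit_E]
  | add a b _ _ ha hb =>
    intro i
    rw [map_add, LinearMap.add_comp, ha, hb, add_zero]
  | mul x y _ _ hx hy =>
    intro i
    ext a
    have hx' (a : YMinus R) (j : ι) : P x (a * E R j) = 0 := LinearMap.congr_fun (hx j) a
    have hy' (a : YMinus R) (j : ι) : P y (a * E R j) = 0 := LinearMap.congr_fun (hy j) a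
    rw [LinearMap.comp_apply, LinearMap.mulRight_apply, hP.mul_left,
      Bialgebra.comul_mul, comul_E, ← (Coalgebra.Repr.arbitrary K a).eq]
    simp [mul_add, Finset.sum_mul, Finset.mul_sum, hx', hy']

/-- The null ideal of a skew pairing in `Y₋`. -/
noncomputable def IsSkewPairing.nullMinus (hP : IsSkewPairing R P) : TwoSidedIdeal (YMinus R) :=
  TwoSidedIdeal.mk' {a | P.flip a = 0} (by simp)
    (by intro a b ha hb; simp only [Set.mem_ofPred_eq] at *; rw [map_add, ha, hb, add_zero])
    (by intro a ha; simp only [Set.mem_ofPred_eq] at *; rw [map_neg, ha, neg_zero])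
    (by intro a b hb; simp only [Set.mem_ofPred_eq] at *; rw [hP.flip_mul, hb]; simp)
    (by intro a b hb; simp only [Set.mem_ofPred_eq] at *; rw [hP.flip_mul, hb]; simp)

/-- The null ideal of a skew pairing in `Y₊`. -/
noncomputable def IsSkewPairing.nullPlus (hP : IsSkewPairing R P) : TwoSidedIdeal (YPlus R) :=
  TwoSidedIdeal.mk' {x | P x = 0} (by simp)
    (by intro x y hx hy; simp only [Set.mem_ofPred_eq] at *; rw [map_add, hx, hy, add_zero])
    (by intro x hx; simp only [Set.mem_ofPred_eq] at *; rw [map_neg, hx, neg_zero])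
    (by intro x y hy; ext a; simp only [Set.mem_ofPred_eq] at hy; rw [hP.mul_left, hy]; simp)
    (by intro x y hy; ext a; simp only [Set.mem_ofPred_eq] at hy; rw [hP.mul_left, hy]; simp)

/-- Against X · (F-word), the last F kills any element of `algT R`; for the empty word, nullity on
`algU R` is the hypothesis. -/
theorem IsSkewPairing.pureNullMinus_le (hP : IsSkewPairing R P) :
    pureNullMinus P ≤ hP.nullMinus := by
  refine TwoSidedIdeal.span_le.2 fun a ha => ?_
  rw [IsSkewPairing.nullMinus, TwoSidedIdeal.coe_mk']
  refine plus_functional_eq_zero fun X hX l => ?_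
  rw [LinearMap.flip_apply]
  induction l using List.reverseRecOn with
  | nil => simpa using ha.2 X hX
  | append_singleton l i =>
    simpa [← mul_assoc] using hP.mul_F_algT ha.1 i (X * (l.map (F R)).prod)

theorem IsSkewPairing.pureNullPlus_le (hP : IsSkewPairing R P) :
    pureNullPlus P ≤ hP.nullPlus := by
  refine TwoSidedIdeal.span_le.2 fun x hx => ?_
  rw [IsSkewPairing.nullPlus, TwoSidedIdeal.coe_mk']
  refine minus_functional_eq_zero fun T hT l => ?_
  induction l using List.reverseRecOn with
  | nil => simpa using hx.2 T hT
  | append_singleton l i =>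
    simpa [← mul_assoc] using hP.algU_mul_E hx.1 i (T * (l.map (E R)).prod)

/-- A linear map vanishing on a two-sided ideal descends to the quotient. -/
theorem exists_ringCon_lift {A V : Type*} [Ring A] [Algebra K A] [AddCommGroup V] [Module K V]
    (I : TwoSidedIdeal A) (f : A →ₗ[K] V) (hf : ∀ a ∈ I, f a = 0) :
    ∃ g : I.ringCon.Quotient →ₗ[K] V, ∀ a, g (I.ringCon.mk' a) = f a := by
  have h (a b : A) (hab : I.ringCon a b) : f a = f b := by
    rw [← sub_eq_zero, ← map_sub]
    exact hf _ ((TwoSidedIdeal.rel_iff _ _ _).1 hab)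
  refine ⟨⟨⟨fun z => Quotient.liftOn' z f h, ?_⟩, ?_⟩, fun a => rfl⟩
  · rintro ⟨a⟩ ⟨b⟩
    exact map_add f a b
  · rintro c ⟨a⟩
    exact map_smul f c a

theorem IsSkewPairing.exists_descent (hP : IsSkewPairing R P) :
    ∃ Q : (pureNullPlus P).ringCon.Quotient →ₗ[K] (pureNullMinus P).ringCon.Quotient →ₗ[K] K,
      ∀ x y, Q ((pureNullPlus P).ringCon.mk' x) ((pureNullMinus P).ringCon.mk' y) = P x y := by
  have hp (x : YPlus R) (hx : x ∈ pureNullPlus P) : P x = 0 := by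
    simpa [IsSkewPairing.nullPlus, TwoSidedIdeal.mem_mk'] using hP.pureNullPlus_le hx
  have hm (a : YMinus R) (ha : a ∈ pureNullMinus P) : P.flip a = 0 := by
    simpa [IsSkewPairing.nullMinus, TwoSidedIdeal.mem_mk'] using hP.pureNullMinus_le ha
  obtain ⟨g, hg⟩ := exists_ringCon_lift _ P hp
  -- After descending in the first variable, the flipped map still vanishes on the ideal in the
  -- second, as seen on representatives.
  obtain ⟨Q, hQ⟩ := exists_ringCon_lift (pureNullMinus P) g.flip fun a ha => by
    ext ⟨x⟩
    exact (LinearMap.congr_fun (hg x) a).trans (LinearMap.congr_fun (hm a ha) x)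
  refine ⟨Q.flip, fun x y => ?_⟩
  rw [LinearMap.flip_apply, hQ, LinearMap.flip_apply, hg]

end Null

end YangBaxter

theorem mainTheorem1 {K ι : Type*} [Field K] [Fintype ι] [DecidableEq ι]
    (R : Matrix (ι × ι) (ι × ι) K) (hR : IsUnit R) (hYB : YangBaxter.YangBaxterEq R) :
    (∃! P : YangBaxter.YPlus R →ₗ[K] YangBaxter.YMinus R →ₗ[K] K,
      YangBaxter.IsSkewPairing R P) ∧
    ∀ P : YangBaxter.YPlus R →ₗ[K] YangBaxter.YMinus R →ₗ[K] K, YangBaxter.IsSkewPairing R P →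
      -- the pairing of words is the braided factorial
      (∀ (N : ℕ) (q a : Fin N → ι),
        P (YangBaxter.wordF R q) (YangBaxter.wordE R a) =
          YangBaxter.braidedFactorial R N q a) ∧
      -- null elements among the homogeneous polynomials in the `E_i`
      (∀ (N : ℕ) (ω : (Fin N → ι) → K),
        (∀ x, P x (∑ a, ω a • YangBaxter.wordE R a) = 0) ↔
          Matrix.mulVec (YangBaxter.braidedFactorial R N) ω = 0) ∧
      -- null elements among the homogeneous polynomials in the `F^i`
      (∀ (N : ℕ) (η : (Fin N → ι) → K),
        (∀ y, P (∑ a, η a • YangBaxter.wordF R a) y = 0) ↔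
          Matrix.vecMul η (YangBaxter.braidedFactorial R N) = 0) ∧
      -- the same after dividing by the ideals generated by the pure-`U` and pure-`T` null ideals
      ∃ Q : (YangBaxter.pureNullPlus P).ringCon.Quotient →ₗ[K]
          (YangBaxter.pureNullMinus P).ringCon.Quotient →ₗ[K] K,
        (∀ x y, Q ((YangBaxter.pureNullPlus P).ringCon.mk' x)
          ((YangBaxter.pureNullMinus P).ringCon.mk' y) = P x y) ∧
        (∀ (N : ℕ) (ω : (Fin N → ι) → K),
          (∀ x, Q x ((YangBaxter.pureNullMinus P).ringCon.mk'
              (∑ a, ω a • YangBaxter.wordE R a)) = 0) ↔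
            Matrix.mulVec (YangBaxter.braidedFactorial R N) ω = 0) ∧
        (∀ (N : ℕ) (η : (Fin N → ι) → K),
          (∀ y, Q ((YangBaxter.pureNullPlus P).ringCon.mk'
              (∑ a, η a • YangBaxter.wordF R a)) y = 0) ↔
            Matrix.vecMul η (YangBaxter.braidedFactorial R N) = 0) := by
  refine ⟨YangBaxter.existsUnique_isSkewPairing hYB, fun P hP => ⟨fun N q a => hP.wordF_wordE q a,
    fun N ω => hP.sum_wordE_null_iff ω, fun N η => hP.sum_wordF_null_iff η, ?_⟩⟩
  obtain ⟨Q, hQ⟩ := hP.exists_descent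
  refine ⟨Q, hQ, fun N ω => ?_, fun N η => ?_⟩
  -- Every class has a representative, so testing against the quotient is testing against `Y₊`.
  · rw [← hP.sum_wordE_null_iff, (RingCon.mk'_surjective _).forall]
    simp only [hQ]
  · rw [← hP.sum_wordF_null_iff, (RingCon.mk'_surjective _).forall]
    simp only [hQ]
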